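/- Let $R$ be a commutative ring with Jacobson radical $J$, let $n$ be a natural number and let $I=\{1,\dots,n,-n,\dots,-1\}$, with $\varepsilon_i=1$ for $i>0$ and $\varepsilon_i=-1$ for $i<0$. Let $\mathrm{Sp}(2n,R)$ be the symplectic group, i.e. the group of invertible matrices $a=(a_{ij})_{i,j\in I}$ over $R$ whose inverse $a^{-1}=(a'_{ij})$ satisfies $a'_{ij}=\varepsilon_i\varepsilon_j a_{-j,-i}$ for all $i,j\in I$, and let $\mathrm{Sp}(2n,R,J)$ be its principal congruence subgroup of level $J$, consisting of the $a\in \mathrm{Sp}(2n,R)$ with $a_{ij}\equiv\delta_{ij} \bmod J$ for all $i,j$. For $i\in I$, $\xi\in R$ put $T_{i,-i}(\xi)=e+\xi e_{i,-i}$, and for $j\neq\pm i$ put $T_{ij}(\xi)=e+\xi e_{ij}-\varepsilon_i\varepsilon_j\xi e_{-j,-i}$. Let $\nu$ be a unitary equivalence relation on $I$, i.e. one such that $i\sim j$ implies $-i\sim -j$. A class $C$ of $\nu$ is self-conjugate if $-C=C$. Assume $h(\nu)\ge(4,5)$, i.e. every self-conjugate class of $\nu$ has at least $4$ elements and every other class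 has at least $5$ elements. Let $\mathrm{Ep}(\nu,R)$ be the subgroup generated by all $T_{i,-i}(\xi)$ with $i\sim -i$ and all $T_{jk}(\xi)$ with $j\sim k$, $j\ne\pm k$, where $\xi\in R$. A form net of ideals $(\sigma,\Gamma)$ over $R$ consists of ideals $\sigma_{ij}$ $(i,j\in I)$ of $R$ with $\sigma_{ik}\sigma_{kj}\le\sigma_{ij}$ and additive subgroups $\Gamma_i$ $(i\in I)$ of $R$ with $2\sigma_{i,-i}\le\Gamma_i\le\sigma_{i,-i}$ and $\xi^2\alpha\in\Gamma_i$ for all $\xi\in\sigma_{ij}$, $\alpha\in\Gamma_j$. It is a unitary D-net if $\sigma_{ij}=\sigma_{-j,-i}$ and $\sigma_{ii}=R$ for all $i,j$, and exact if $\sigma_{i,-i}=\sum_{k\ne\pm i}\sigma_{ik}\sigma_{k,-i}+\langle\Gamma_i\rangle$ for all $i$, where $\langle\Gamma_i\rangle$ is the ideal generated by $\Gamma_i$. Let $\mathrm{Ep}(\sigma,\Gamma)$ be the subgroup generated by all $T_{ij}(\xi)$ with $i\neq\pm j$, $\xi\in\sigma_{ij}$, and all $T_{i,-i}(\alpha)$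 with $\alpha\in\Gamma_i$, and let $$\mathrm{Sp}(\sigma,\Gamma)=\Big\{g\in \mathrm{Sp}(2n,R) \;\Big|\; g_{ij}\in\sigma_{ij}\text{ and } \sum_{k>0}g_{ik}g'_{k,-i}\in\Gamma_i\text{ for all } i,j\in I\Big\},$$ where $(g'_{ij})=g^{-1}$. Let $H$ be a subgroup of $\mathrm{Sp}(2n,R)$ with $\mathrm{Ep}(\nu,R)\le H$, and let $(\sigma,\Gamma)$ be the form net associated with $H$, i.e. the greatest (with respect to componentwise inclusion) among the unitary exact form D-nets $(\sigma',\Gamma')$ with $\mathrm{Ep}(\sigma',\Gamma')\le H$. Then $$H\cap \mathrm{Sp}(2n,R,J)\le \mathrm{Sp}(\sigma,\Gamma).$$ -/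

import Mathlib

namespace SympNet

/-- The index set `{1, …, n, -n, …, -1}`: `Sum.inl k` is the `k`-th positive index and
`Sum.inr k` is its negative. -/
abbrev Idx (n : ℕ) : Type := Fin n ⊕ Fin n

/-- The involution `i ↦ -i` of the index set. -/
def neg {n : ℕ} (i : Idx n) : Idx n := Sum.swap i

/-- The sign `ε i` of an index, as an element of the ring `R`. -/
def sgn (R : Type*) [CommRing R] {n : ℕ} : Idx n → R
  | Sum.inl _ => 1
  | Sum.inr _ => -1

/-- The symplectic group `Sp(2n, R)`. Its elements `a` are the matrices whose inverse has the
entries `ε i * ε j * a (-j) (-i)`, see `inv_apply` below. -/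
abbrev Sp (n : ℕ) (R : Type*) [CommRing R] : Type _ := ↥(Matrix.symplecticGroup (Fin n) R)

theorem neg_neg {n : ℕ} (i : Idx n) : neg (neg i) = i := Sum.swap_swap i

theorem neg_ne {n : ℕ} (i : Idx n) : neg i ≠ i := by
  rcases i with i | i <;> simp [neg]

theorem neg_inj {n : ℕ} {i j : Idx n} (h : neg i = neg j) : i = j := by
  rw [← neg_neg i, h, neg_neg]

section Transvections

variable {n : ℕ} {R : Type*} [CommRing R]

theorem sgn_neg (i : Idx n) : sgn R (neg i) = - sgn R i := by
  rcases i with i | i <;> simp [neg, sgn]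

theorem sgn_mul_sgn (i : Idx n) : sgn R i * sgn R i = 1 := by
  rcases i with i | i <;> simp [sgn]

theorem J_apply (i j : Idx n) :
    Matrix.J (Fin n) R i j = if j = neg i then - sgn R i else 0 := by
  rcases i with i | i <;> rcases j with j | j
  · simp [Matrix.J, neg]
  · by_cases h : i = j
    · subst h; simp [Matrix.J, neg, sgn]
    · simp [Matrix.J, neg, h, Ne.symm h]
  · by_cases h : i = j
    · subst h; simp [Matrix.J, neg, sgn]
    · simp [Matrix.J, neg, h, Ne.symm h]
  · simp [Matrix.J, neg]

theorem single_mul_J (i j : Idx n) (ξ : R) :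
    Matrix.single i j ξ * Matrix.J (Fin n) R = Matrix.single i (neg j) (- (ξ * sgn R j)) := by
  ext a b
  by_cases h : a = i
  · subst h
    rw [Matrix.single_mul_apply_same, J_apply]
    by_cases h' : b = neg j
    · subst h'; simp
    · simp [h', Ne.symm h']
  · rw [Matrix.single_mul_apply_of_ne _ _ _ _ _ h, Matrix.single_apply,
      if_neg (fun h' => h h'.1.symm)]

theorem J_mul_single (i j : Idx n) (ξ : R) :
    Matrix.J (Fin n) R * Matrix.single i j ξ = Matrix.single (neg i) j (sgn R i * ξ) := by
  ext a b
  by_cases h : b = j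
  · subst h
    rw [Matrix.mul_single_apply_same, J_apply]
    by_cases h' : i = neg a
    · subst h'; simp [neg_neg, sgn_neg]
    · have h2 : ¬ (neg i = a) := fun h2 => h' (by rw [← h2, neg_neg])
      simp [h', h2]
  · rw [Matrix.mul_single_apply_of_ne _ _ _ _ _ h, Matrix.single_apply,
      if_neg (fun h' => h h'.2.symm)]

theorem inv_apply (a : Sp n R) (i j : Idx n) :
    (a⁻¹).1 i j = sgn R i * sgn R j * a.1 (neg j) (neg i) := by
  have h : (a⁻¹).1 = (-Matrix.J (Fin n) R) * (a.1).transpose * Matrix.J (Fin n) R :=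
    SymplecticGroup.coe_inv a
  rw [h, Matrix.mul_apply, Finset.sum_eq_single (neg j)]
  · rw [Matrix.mul_apply, Finset.sum_eq_single (neg i)]
    · simp [J_apply, neg_neg, sgn_neg]; ring
    · intro b _ hb; simp [J_apply, hb]
    · simp
  · intro b _ hb
    have : ¬ (j = neg b) := fun h => hb (by rw [h, neg_neg])
    simp [J_apply, this]
  · simp

/-- The matrix `e + ξ e_{i,-i}`. -/
def longMat (i : Idx n) (ξ : R) : Matrix (Idx n) (Idx n) R :=
  1 + Matrix.single i (neg i) ξ

/-- The matrix `e + ξ e_{ij} - ε_i ε_j ξ e_{-j,-i}`. -/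
def shortMat (i j : Idx n) (ξ : R) : Matrix (Idx n) (Idx n) R :=
  1 + Matrix.single i j ξ - Matrix.single (neg j) (neg i) (sgn R i * sgn R j * ξ)

theorem longMat_mem (i : Idx n) (ξ : R) :
    longMat i ξ ∈ Matrix.symplecticGroup (Fin n) R := by
  rw [SymplecticGroup.mem_iff, longMat, Matrix.transpose_add, Matrix.transpose_one,
    Matrix.transpose_single, add_mul, one_mul, single_mul_J, mul_add, mul_one, add_mul,
    J_mul_single, Matrix.single_mul_single_of_ne _ _ _ _ (by rw [neg_neg]; exact (neg_ne i).symm),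
    neg_neg, sgn_neg, add_zero]
  rw [add_assoc, ← Matrix.single_add]
  simp [mul_comm]

theorem shortMat_mem (i j : Idx n) (hij : j ≠ i) (hij' : j ≠ neg i) (ξ : R) :
    shortMat i j ξ ∈ Matrix.symplecticGroup (Fin n) R := by
  have h1 : neg j ≠ i := fun h => hij' (by rw [← h, neg_neg])
  have h2 : neg j ≠ neg i := fun h => hij (neg_inj h)
  rw [SymplecticGroup.mem_iff, shortMat, Matrix.transpose_sub, Matrix.transpose_add,
    Matrix.transpose_one, Matrix.transpose_single, Matrix.transpose_single]
  simp only [add_mul, sub_mul, mul_add, mul_sub, one_mul, mul_one, single_mul_J, J_mul_single,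
    neg_neg, sgn_neg]
  rw [Matrix.single_mul_single_of_ne _ _ _ _ (neg_ne j),
    Matrix.single_mul_single_of_ne _ _ _ _ h2, Matrix.single_mul_single_of_ne _ _ _ _ hij.symm,
    Matrix.single_mul_single_of_ne _ _ _ _ (neg_ne i).symm]
  have e2 : -sgn R i * (sgn R i * sgn R j * ξ) = - (ξ * sgn R j) := by
    linear_combination (-sgn R j * ξ) * sgn_mul_sgn (R := R) i
  have e1 : -(sgn R i * sgn R j * ξ * -sgn R i) = sgn R j * ξ := by
    linear_combination (sgn R j * ξ) * sgn_mul_sgn (R := R) i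
  rw [e1, e2]
  abel

/-- The long transvection `T_{i,-i}(ξ)`. -/
def longT (i : Idx n) (ξ : R) : Sp n R := ⟨longMat i ξ, longMat_mem i ξ⟩

/-- The short transvection `T_{ij}(ξ)`, where `i ≠ ±j`. -/
def shortT (i j : Idx n) (hij : j ≠ i) (hij' : j ≠ neg i) (ξ : R) : Sp n R :=
  ⟨shortMat i j ξ, shortMat_mem i j hij hij' ξ⟩

/-- The length `S_{i,-i}(g) = ∑_{j > 0} g_{ij} g'_{j,-i}` of the row `g_{i*}`, where `g'` is the
inverse of `g`. -/
def rowLength (g : Sp n R) (i : Idx n) : R :=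
  ∑ k : Fin n, g.1 i (Sum.inl k) * (g⁻¹).1 (Sum.inl k) (neg i)

/-- The principal congruence subgroup `Sp(2n, R, J)`: the symplectic matrices which become the
identity matrix modulo the ideal `J`. -/
def congruenceSubgroup (n : ℕ) (J : Ideal R) : Subgroup (Sp n R) :=
  MonoidHom.ker (((Ideal.Quotient.mk J).mapMatrix : Matrix (Idx n) (Idx n) R →+* _).toMonoidHom.comp
    (Matrix.symplecticGroup (Fin n) R).subtype)

theorem mem_congruenceSubgroup {J : Ideal R} {g : Sp n R} :
    g ∈ congruenceSubgroup n J ↔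
      ∀ i j, g.1 i j - (1 : Matrix (Idx n) (Idx n) R) i j ∈ J := by
  rw [congruenceSubgroup, MonoidHom.mem_ker, ← Matrix.ext_iff]
  refine forall_congr' fun i => forall_congr' fun j => ?_
  rw [← Ideal.Quotient.eq]
  by_cases h : i = j
  · subst h; simp
  · simp [h]

end Transvections

section EquivalenceRelations

variable {n : ℕ}

/-- An equivalence relation on the index set is unitary if `i ∼ j` implies `-i ∼ -j`. -/
def IsUnitaryRel (ν : Setoid (Idx n)) : Prop :=
  ∀ i j, ν i j → ν (neg i) (neg j)

/-- A set of indices is self-conjugate if it is stable under `i ↦ -i`. -/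
def IsSelfConj (C : Set (Idx n)) : Prop := ∀ i ∈ C, neg i ∈ C

/-- The pair `h(ν)` of the minimal size of a self-conjugate class of `ν` and the minimal size of a
non-self-conjugate class of `ν`; each is `∞` if there is no such class. -/
noncomputable def minSizes (ν : Setoid (Idx n)) : ℕ∞ × ℕ∞ :=
  (⨅ C ∈ {C | C ∈ ν.classes ∧ IsSelfConj C}, C.encard,
    ⨅ C ∈ {C | C ∈ ν.classes ∧ ¬ IsSelfConj C}, C.encard)

/-- The elementary block-diagonal subgroup `Ep(ν, R)`. -/
def blockElem (ν : Setoid (Idx n)) (R : Type*) [CommRing R] : Subgroup (Sp n R) :=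
  Subgroup.closure
    ({g | ∃ (i : Idx n) (ξ : R), ν i (neg i) ∧ g = longT i ξ} ∪
      {g | ∃ (j k : Idx n) (hjk : k ≠ j) (hjk' : k ≠ neg j) (ξ : R),
        ν j k ∧ g = shortT j k hjk hjk' ξ})

end EquivalenceRelations

/-- A form net of ideals `(σ, Γ)` over `R`: a net `σ` of ideals with a column `Γ` of form
parameters for `σ`. -/
structure FormNet (n : ℕ) (R : Type*) [CommRing R] where
  /-- the net of ideals -/
  σ : Idx n → Idx n → Ideal R
  /-- the column of form parameters -/
  Γ : Idx n → AddSubgroup R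
  mul_le : ∀ i j k, σ i k * σ k j ≤ σ i j
  two_mul_mem : ∀ i, ∀ α ∈ σ i (neg i), 2 * α ∈ Γ i
  mem_of_mem_form : ∀ i, ∀ α ∈ Γ i, α ∈ σ i (neg i)
  sq_mul_mem : ∀ i j, ∀ ξ ∈ σ i j, ∀ α ∈ Γ j, ξ ^ 2 * α ∈ Γ i

namespace FormNet

variable {n : ℕ} {R : Type*} [CommRing R]

/-- The order on form nets: inclusion in every component. -/
instance : LE (FormNet n R) :=
  ⟨fun N N' => (∀ i j, N.σ i j ≤ N'.σ i j) ∧ ∀ i, N.Γ i ≤ N'.Γ i⟩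

/-- The net is unitary: `σ_{ij} = σ_{-j,-i}`. -/
def IsUnitary (N : FormNet n R) : Prop := ∀ i j, N.σ i j = N.σ (neg j) (neg i)

/-- The net is a D-net: `σ_{ii} = R`. -/
def IsDNet (N : FormNet n R) : Prop := ∀ i, N.σ i i = ⊤

/-- The form net is exact: `σ_{i,-i} = ∑_{k ≠ ±i} σ_{ik} σ_{k,-i} + ⟨Γ_i⟩`. -/
def IsExact (N : FormNet n R) : Prop :=
  ∀ i, N.σ i (neg i) =
    (⨆ k ∈ {k : Idx n | k ≠ i ∧ k ≠ neg i}, N.σ i k * N.σ k (neg i)) ⊔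
      Ideal.span (N.Γ i : Set R)

/-- The elementary form net subgroup `Ep(σ, Γ)`. -/
def elem (N : FormNet n R) : Subgroup (Sp n R) :=
  Subgroup.closure
    ({g | ∃ (i j : Idx n) (hij : j ≠ i) (hij' : j ≠ neg i) (ξ : R),
        ξ ∈ N.σ i j ∧ g = shortT i j hij hij' ξ} ∪
      {g | ∃ (i : Idx n) (α : R), α ∈ N.Γ i ∧ g = longT i α})

/-- The form net subgroup `Sp(σ, Γ)`, as a set of symplectic matrices. -/
def sp (N : FormNet n R) : Set (Sp n R) :=
  {g | (∀ i j, g.1 i j ∈ N.σ i j) ∧ ∀ i, rowLength g i ∈ N.Γ i}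

/-- `N` is the form net associated with `H`: the greatest one among the unitary exact form D-nets
whose elementary form net subgroup is contained in `H`. -/
def IsAssociated (N : FormNet n R) (H : Subgroup (Sp n R)) : Prop :=
  (N.IsUnitary ∧ N.IsDNet ∧ N.IsExact ∧ N.elem ≤ H) ∧
    ∀ N' : FormNet n R, N'.IsUnitary → N'.IsDNet → N'.IsExact → N'.elem ≤ H → N' ≤ N

end FormNet

end SympNet

/-! For vectors `a`, `v` with ⟨a, v⟩ = 0, the transformations `heis a v β` with `a` fixed form a
Heisenberg group. Conjugation by a symplectic `g` replaces `a`, `v` by `g a`, `g v`, and the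
elementary transvections are the cases where `a` is a basis vector and `v` is a multiple of another
one or zero.

Level. Commutators with block transvections show that membership of a root element in `H` depends
only on the classes of its indices. The parameters that occur form a unitary exact form D-net
`levelNet` whose elementary group lies in `H`; by maximality it is contained in (σ, Γ). So the
parameter of each short or long root element of `H` lies in σ or Γ (`FormNet.IsAssociated.isLevel`),
and it remains to manufacture root elements of `H` carrying the entries and lengths of `g`.

Entries. Conjugating a block root element by `g` and taking a commutator with a block transvection
gives the element of `H` with data `e_{-k}` and the column `g e_r`, provided `g` has a few zeros
(`heis_of_zeros`); two more commutators isolate one coordinate (`mem_of_heis`). Columns with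
self-conjugate class use a long root element instead (`mem_of_self`). Modulo the radical `g` is the
identity, so its diagonal entries are units and any entry already known to lie in σ can be cleared
inside `H`. The obstacle is the block of entries `g_{-a,r}` with `a ∼ r`: some of them must vanish
before the argument starts. For these it is applied to a conjugate `g T g⁻¹`, where the needed zeros
are available. This yields 2×2 minors of `g` (`minor_mem`), and two minors determine the entry
because a determinant is a unit.

Lengths. Once the entries are known, the coordinates of `g e_r` give short root elements of `H`.
Removing their product from the element with data `e_{-k}`, `g e_r` leaves, by the Heisenberg
cocycle, a long root element whose parameter is the length, up to sign (`quad_mem_of_heis`). -/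

namespace SympNet

/-! ### Heisenberg groups in the symplectic group. -/

section Heisenberg

open Matrix

variable {n : ℕ} {R : Type*} [CommRing R]

/-- The linear form `⟨v, ·⟩` given by the symplectic form, as a row vector. -/
def sharp (v : Idx n → R) : Idx n → R := fun j => -(sgn R j * v (neg j))

/-- The standard basis vector `e_i`. -/
abbrev bv (R : Type*) [CommRing R] {n : ℕ} (i : Idx n) : Idx n → R := Pi.single i 1

theorem sum_neg (f : Idx n → R) : ∑ i, f (neg i) = ∑ i, f i :=
  Equiv.sum_comp (Equiv.sumComm (Fin n) (Fin n)) f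

theorem sharp_add (v w : Idx n → R) : sharp (v + w) = sharp v + sharp w := by
  ext j; simp [sharp]; ring

theorem sharp_smul (c : R) (v : Idx n → R) : sharp (c • v) = c • sharp v := by
  ext j; simp [sharp]; ring

theorem sharp_dotProduct_comm (v w : Idx n → R) : sharp v ⬝ᵥ w = -(sharp w ⬝ᵥ v) := by
  simp only [dotProduct, sharp]
  rw [← sum_neg, ← Finset.sum_neg_distrib]
  refine Finset.sum_congr rfl fun i _ => ?_
  rw [neg_neg, sgn_neg]; ring

theorem sharp_dotProduct_self (v : Idx n → R) : sharp v ⬝ᵥ v = 0 := by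
  simp only [dotProduct, sharp]
  rw [Fintype.sum_sum_type, ← Finset.sum_add_distrib]
  refine Finset.sum_eq_zero fun i _ => ?_
  simp [sgn, neg]; ring

theorem dotProduct_bv (v : Idx n → R) (i : Idx n) : v ⬝ᵥ bv R i = v i := by
  simp [bv]

theorem sharp_bv_dotProduct (i : Idx n) (v : Idx n → R) :
    sharp (bv R i) ⬝ᵥ v = sgn R i * v (neg i) := by
  rw [sharp_dotProduct_comm, dotProduct_bv]; simp [sharp]

theorem sharp_mulVec (g : Sp n R) (v : Idx n → R) :
    sharp (g.1 *ᵥ v) = sharp v ᵥ* (g⁻¹).1 := by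
  ext j
  simp only [sharp, mulVec, vecMul, dotProduct]
  rw [← sum_neg (fun i => -(sgn R i * v (neg i)) * (g⁻¹).1 i j), Finset.mul_sum,
    ← Finset.sum_neg_distrib]
  refine Finset.sum_congr rfl fun i _ => ?_
  rw [inv_apply, neg_neg, sgn_neg]
  linear_combination (v i * g.1 (neg j) i * sgn R j) * sgn_mul_sgn (R := R) i

theorem coe_inv_mul (g : Sp n R) : (g⁻¹).1 * g.1 = 1 := by
  exact congrArg Subtype.val (inv_mul_cancel g)

theorem coe_mul_inv (g : Sp n R) : g.1 * (g⁻¹).1 = 1 := by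
  exact congrArg Subtype.val (mul_inv_cancel g)

theorem sharp_mulVec_dotProduct (g : Sp n R) (v w : Idx n → R) :
    sharp (g.1 *ᵥ v) ⬝ᵥ (g.1 *ᵥ w) = sharp v ⬝ᵥ w := by
  rw [sharp_mulVec, ← dotProduct_mulVec, mulVec_mulVec, coe_inv_mul, one_mulVec]

/-- The element `x ↦ x + ⟨v, x⟩ a + ⟨a, x⟩ v + β ⟨a, x⟩ a` of the unipotent radical of the
stabilizer of the line spanned by `a`; here `v` should be orthogonal to `a`. -/
def heis (a v : Idx n → R) (β : R) : Matrix (Idx n) (Idx n) R :=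
  1 + vecMulVec a (sharp v) + vecMulVec v (sharp a) + β • vecMulVec a (sharp a)

/-- The Heisenberg group law. Its cocycle ⟨v, w⟩ is what eventually turns short root data into row
lengths. -/
theorem heis_mul (a v w : Idx n → R) (β γ : R) (hv : sharp a ⬝ᵥ v = 0) (hw : sharp a ⬝ᵥ w = 0) :
    heis a v β * heis a w γ = heis a (v + w) (β + γ + sharp v ⬝ᵥ w) := by
  have h1 := sharp_dotProduct_self a
  have h2 : sharp v ⬝ᵥ a = 0 := by rw [sharp_dotProduct_comm, hv, neg_zero]
  simp only [heis, add_mul, mul_add, one_mul, mul_one, vecMulVec_mul_vecMulVec, h1, h2, hw,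
    smul_mul_assoc, mul_smul_comm, sharp_add, vecMulVec_add, add_vecMulVec, add_smul, zero_smul,
    smul_zero, vecMulVec_zero, vecMulVec_smul]
  abel_nf

theorem heis_zero (a : Idx n → R) : heis a 0 0 = 1 := by
  have : sharp (0 : Idx n → R) = 0 := by ext; simp [sharp]
  simp [heis, this]

theorem heis_comm (a v : Idx n → R) : heis a v 0 = heis v a 0 := by
  simp [heis]; abel

theorem heis_smul_left (a v : Idx n → R) (c : R) : heis (c • a) v 0 = heis a (c • v) 0 := by
  simp [heis, sharp_smul, smul_vecMulVec, vecMulVec_smul]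

theorem heis_smul_self (a : Idx n → R) (c : R) : heis a (c • a) 0 = heis a 0 (2 * c) := by
  have : sharp (0 : Idx n → R) = 0 := by ext; simp [sharp]
  simp [heis, sharp_smul, smul_vecMulVec, vecMulVec_smul, this, two_mul, add_smul, add_assoc]

/-- Polarization of β x xᵗ from `u` to `u + v`: the quotient of two long-type elements is an element
of mixed type based at `v`. -/
theorem heis_add_mul (u v : Idx n → R) (β : R) (h : sharp u ⬝ᵥ v = 0) :
    heis (u + v) 0 β * heis u 0 (-β) = heis v (β • u) β := by
  have h0 : sharp (0 : Idx n → R) = 0 := by ext; simp [sharp]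
  have h1 := sharp_dotProduct_self u
  have h2 : sharp v ⬝ᵥ u = 0 := by rw [sharp_dotProduct_comm, h, neg_zero]
  simp only [heis, h0, sharp_add, sharp_smul, vecMulVec_zero, zero_vecMulVec, add_zero, add_mul,
    mul_add, one_mul, mul_one, vecMulVec_mul_vecMulVec, h1, h2, smul_mul_assoc, mul_smul_comm,
    smul_zero, vecMulVec_smul, smul_vecMulVec, zero_smul, add_vecMulVec, vecMulVec_add, smul_add,
    neg_smul, mul_neg]
  abel

theorem heis_mulVec (a v x : Idx n → R) (β : R) :
    heis a v β *ᵥ x =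
      x + (sharp v ⬝ᵥ x) • a + (sharp a ⬝ᵥ x) • v + (β * (sharp a ⬝ᵥ x)) • a := by
  simp [heis, add_mulVec, smul_mulVec, vecMulVec_mulVec, smul_smul]

theorem mul_heis_mul_inv (g : Sp n R) (a v : Idx n → R) (β : R) :
    g.1 * heis a v β * (g⁻¹).1 = heis (g.1 *ᵥ a) (g.1 *ᵥ v) β := by
  simp only [heis, mul_add, add_mul, mul_one, coe_mul_inv, mul_smul_comm, smul_mul_assoc,
    mul_vecMulVec, vecMulVec_mul, sharp_mulVec]

theorem shortT_val (i j : Idx n) (hij : j ≠ i) (hij' : j ≠ neg i) (ξ : R) :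
    (shortT i j hij hij' ξ).1 = heis (bv R i) ((-(sgn R j * ξ)) • bv R (neg j)) 0 := by
  have h : ∀ (a b : Idx n) (c : R),
      vecMulVec (c • bv R a) (sharp (bv R b)) = single a (neg b) (c * sgn R b) := by
    intro a b c
    ext x y
    by_cases h1 : x = a
    · by_cases h2 : y = neg b
      · subst h1 h2; simp [vecMulVec_apply, sharp, neg_neg, sgn_neg]
      · have h3 : neg y ≠ b := fun h => h2 (by rw [← h, neg_neg])
        simp [vecMulVec_apply, sharp, h3, Ne.symm h2]
    · simp [vecMulVec_apply, h1, Ne.symm h1]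
  have e : vecMulVec (bv R i) (sharp (bv R (neg j))) = single i j (- sgn R j) := by
    have := h i (neg j) 1
    rwa [one_smul, neg_neg, one_mul, sgn_neg] at this
  show shortMat i j ξ = _
  rw [heis, shortMat, sharp_smul, vecMulVec_smul, e, h, smul_single]
  have e1 : -(sgn R j * ξ) • -sgn R j = ξ := by
    simp only [smul_eq_mul]
    linear_combination ξ * sgn_mul_sgn (R := R) j
  have e2 : -(sgn R j * ξ) * sgn R i = -(sgn R i * sgn R j * ξ) := by ring
  have e3 : single (neg j) (neg i) (-(sgn R i * sgn R j * ξ)) =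
      -single (neg j) (neg i) (sgn R i * sgn R j * ξ) := by
    ext x y; simp only [single_apply, Matrix.neg_apply]; split_ifs <;> simp
  rw [zero_smul, add_zero, e1, e2, e3, sub_eq_add_neg]

theorem longT_val (i : Idx n) (ξ : R) :
    (longT i ξ).1 = heis (bv R i) 0 (sgn R i * ξ) := by
  have h0 : sharp (0 : Idx n → R) = 0 := by ext; simp [sharp]
  show longMat i ξ = _
  rw [heis, longMat, h0, vecMulVec_zero, zero_vecMulVec, add_zero, add_zero]
  congr 1
  ext x y
  by_cases h1 : x = i
  · by_cases h2 : y = neg i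
    · subst h1 h2
      simp [vecMulVec_apply, sharp, neg_neg, sgn_neg]
      linear_combination (-ξ) * sgn_mul_sgn (R := R) x
    · have h3 : neg y ≠ i := fun h => h2 (by rw [← h, neg_neg])
      simp [vecMulVec_apply, sharp, h3, Ne.symm h2]
  · simp [vecMulVec_apply, h1, Ne.symm h1]

theorem shortT_mulVec (i j : Idx n) (hij : j ≠ i) (hij' : j ≠ neg i) (ξ : R) (x : Idx n → R) :
    (shortT i j hij hij' ξ).1 *ᵥ x =
      x + (ξ * x j) • bv R i - (sgn R i * sgn R j * ξ * x (neg i)) • bv R (neg j) := by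
  rw [shortT_val, heis_mulVec, sharp_smul, smul_dotProduct, sharp_bv_dotProduct,
    sharp_bv_dotProduct, neg_neg, sgn_neg, zero_mul, zero_smul, add_zero, sub_eq_add_neg,
    ← neg_smul, smul_smul, smul_eq_mul]
  congr 3
  · linear_combination (ξ * x j) * sgn_mul_sgn (R := R) j
  · ring

theorem shortT_mul_apply (i j : Idx n) (hij : j ≠ i) (hij' : j ≠ neg i) (ξ : R) (g : Sp n R)
    (a b : Idx n) :
    (shortT i j hij hij' ξ * g).1 a b =
      g.1 a b + (if a = i then ξ * g.1 j b else 0) -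
        (if a = neg j then sgn R i * sgn R j * ξ * g.1 (neg i) b else 0) := by
  have := congrFun (shortT_mulVec i j hij hij' ξ (fun x => g.1 x b)) a
  have e : ((shortT i j hij hij' ξ).1 *ᵥ (fun x => g.1 x b)) a
      = (shortT i j hij hij' ξ * g).1 a b := rfl
  rw [e] at this
  rw [this]
  simp [Pi.single_apply]

end Heisenberg

end SympNet

namespace SympNet

/-! ### Root elements of a subgroup and commutator formulas. -/

section Membership

open Matrix

variable {n : ℕ} {R : Type*} [CommRing R] {H : Subgroup (Sp n R)}

theorem ne_neg_comm {i j : Idx n} : i ≠ neg j ↔ j ≠ neg i := by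
  constructor <;> intro h h' <;> exact h (by rw [h', neg_neg])

theorem neg_ne_iff {i j : Idx n} : neg i ≠ j ↔ i ≠ neg j := by
  rw [ne_comm, ne_neg_comm]

theorem neg_ne_neg_iff {i j : Idx n} : neg i ≠ neg j ↔ i ≠ j :=
  ⟨fun h h' => h (by rw [h']), fun h h' => h (neg_inj h')⟩

theorem sgn_eq_or (R : Type*) [CommRing R] (i : Idx n) : sgn R i = 1 ∨ sgn R i = -1 := by
  rcases i with i | i <;> simp [sgn]

theorem isUnit_sgn (R : Type*) [CommRing R] (i : Idx n) : IsUnit (sgn R i) :=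
  IsUnit.of_mul_eq_one _ (sgn_mul_sgn i)

/-- The matrix `M` is an element of the subgroup `H` of the symplectic group. -/
def InSub (H : Subgroup (Sp n R)) (M : Matrix (Idx n) (Idx n) R) : Prop :=
  ∃ h ∈ H, (h : Sp n R).1 = M

theorem inSub_val {g : Sp n R} : InSub H g.1 ↔ g ∈ H :=
  ⟨fun ⟨_, hh, e⟩ => Subtype.ext e ▸ hh, fun h => ⟨g, h, rfl⟩⟩

theorem InSub.mul {M M' : Matrix (Idx n) (Idx n) R} (h : InSub H M) (h' : InSub H M') :
    InSub H (M * M') := by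
  obtain ⟨g, hg, rfl⟩ := h
  obtain ⟨g', hg', rfl⟩ := h'
  exact ⟨g * g', H.mul_mem hg hg', rfl⟩

theorem InSub.of_mul_eq_one {M M' : Matrix (Idx n) (Idx n) R} (h : InSub H M) (e : M * M' = 1) :
    InSub H M' := by
  obtain ⟨g, hg, rfl⟩ := h
  refine ⟨g⁻¹, H.inv_mem hg, ?_⟩
  calc (g⁻¹).1 = (g⁻¹).1 * (g.1 * M') := by rw [e, mul_one]
    _ = M' := by rw [← mul_assoc, coe_inv_mul, one_mul]

theorem InSub.heis_conj {a v : Idx n → R} {β : R} (h : InSub H (heis a v β)) {g : Sp n R}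
    (hg : g ∈ H) : InSub H (heis (g.1 *ᵥ a) (g.1 *ᵥ v) β) := by
  rw [← mul_heis_mul_inv]
  exact ((inSub_val.2 hg).mul h).mul (inSub_val.2 (H.inv_mem hg))

theorem InSub.heis_mul {a v w : Idx n → R} {β γ : R} (h : InSub H (heis a v β))
    (h' : InSub H (heis a w γ)) (hv : sharp a ⬝ᵥ v = 0) (hw : sharp a ⬝ᵥ w = 0) :
    InSub H (heis a (v + w) (β + γ + sharp v ⬝ᵥ w)) := by
  rw [← SympNet.heis_mul a v w β γ hv hw]
  exact h.mul h'

theorem InSub.heis_neg {a v : Idx n → R} {β : R} (h : InSub H (heis a v β))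
    (hv : sharp a ⬝ᵥ v = 0) : InSub H (heis a (-v) (-β)) := by
  refine h.of_mul_eq_one ?_
  rw [SympNet.heis_mul a v (-v) β (-β) hv (by rw [dotProduct_neg, hv, neg_zero]), dotProduct_neg,
    sharp_dotProduct_self, add_neg_cancel, add_neg_cancel, neg_zero, add_zero, heis_zero]

/-- As `t` fixes `a`, the commutator stays in the same Heisenberg group. The unknown β cancels, and
only the displacement of `v` under `t` survives, up to the cocycle. -/
theorem InSub.heis_commutator {a v : Idx n → R} {β : R} (h : InSub H (heis a v β))
    (hv : sharp a ⬝ᵥ v = 0) {t : Sp n R} (ht : t ∈ H) (hta : t.1 *ᵥ a = a) :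
    InSub H (heis a (t.1 *ᵥ v - v) (-(sharp (t.1 *ᵥ v) ⬝ᵥ v))) := by
  have h1 := h.heis_conj ht
  have h2 := sharp_mulVec_dotProduct t a v
  rw [hta] at h1 h2
  have := h1.heis_mul (h.heis_neg hv) (h2.trans hv) (by rw [dotProduct_neg, hv, neg_zero])
  rwa [← sub_eq_add_neg, add_neg_cancel, zero_add, dotProduct_neg] at this

/-- The short root element with root vectors `e_a`, `e_b` and parameter `ξ` belongs to `H`. -/
def InRoot (H : Subgroup (Sp n R)) (a b : Idx n) (ξ : R) : Prop :=
  InSub H (heis (bv R a) (ξ • bv R b) 0)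

/-- The long root element with root vector `e_a` and parameter `β` belongs to `H`. -/
def InLong (H : Subgroup (Sp n R)) (a : Idx n) (β : R) : Prop :=
  InSub H (heis (bv R a) 0 β)

theorem InRoot.symm {a b : Idx n} {ξ : R} (h : InRoot H a b ξ) : InRoot H b a ξ := by
  unfold InRoot at *
  rwa [heis_comm, heis_smul_left] at h

theorem sharp_bv_smul {a b : Idx n} (hab : b ≠ neg a) (ξ : R) :
    sharp (bv R a) ⬝ᵥ (ξ • bv R b) = 0 := by
  rw [sharp_bv_dotProduct]; simp [hab.symm]

theorem InRoot.add {a b : Idx n} (hab : b ≠ neg a) {ξ ζ : R} (h : InRoot H a b ξ)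
    (h' : InRoot H a b ζ) : InRoot H a b (ξ + ζ) := by
  have := h.heis_mul h' (sharp_bv_smul hab ξ) (sharp_bv_smul hab ζ)
  rw [← add_smul, sharp_smul, smul_dotProduct, sharp_bv_smul (neg_ne b).symm, smul_zero,
    add_zero, add_zero] at this
  exact this

theorem InRoot.neg_param {a b : Idx n} (hab : b ≠ neg a) {ξ : R} (h : InRoot H a b ξ) :
    InRoot H a b (-ξ) := by
  have := h.heis_neg (sharp_bv_smul hab ξ)
  rwa [← neg_smul, neg_zero] at this

theorem inRoot_zero (H : Subgroup (Sp n R)) (a b : Idx n) : InRoot H a b 0 := by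
  refine ⟨1, H.one_mem, ?_⟩
  rw [zero_smul, heis_zero]; rfl

theorem InRoot.of_neg {a b : Idx n} (hab : b ≠ neg a) {ξ : R} (h : InRoot H a b (-ξ)) :
    InRoot H a b ξ := by
  simpa using h.neg_param hab

theorem inRoot_sgn_mul {a b : Idx n} (hab : b ≠ neg a) (i : Idx n) {ξ : R} :
    InRoot H a b (sgn R i * ξ) ↔ InRoot H a b ξ := by
  rcases sgn_eq_or R i with h | h
  · rw [h, one_mul]
  · rw [h, neg_one_mul]
    exact ⟨fun h => h.of_neg hab, fun h => h.neg_param hab⟩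

theorem InLong.add {a : Idx n} {β γ : R} (h : InLong H a β) (h' : InLong H a γ) :
    InLong H a (β + γ) := by
  have := InSub.heis_mul h h' (dotProduct_zero _) (dotProduct_zero _)
  rwa [add_zero, dotProduct_zero, add_zero] at this

theorem InLong.neg_param {a : Idx n} {β : R} (h : InLong H a β) : InLong H a (-β) := by
  have := InSub.heis_neg h (dotProduct_zero _)
  rwa [neg_zero] at this

theorem inLong_zero (H : Subgroup (Sp n R)) (a : Idx n) : InLong H a 0 :=
  ⟨1, H.one_mem, (heis_zero _).symm⟩

theorem inLong_sgn_mul {a : Idx n} (i : Idx n) {β : R} :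
    InLong H a (sgn R i * β) ↔ InLong H a β := by
  rcases sgn_eq_or R i with h | h
  · rw [h, one_mul]
  · rw [h, neg_one_mul]
    exact ⟨fun h => by simpa using h.neg_param, fun h => h.neg_param⟩

theorem inLong_two_mul {a : Idx n} {ξ : R} : InLong H a (2 * ξ) ↔ InRoot H a a ξ := by
  rw [InLong, InRoot, heis_smul_self]

theorem longT_mem_iff {i : Idx n} {β : R} : longT i β ∈ H ↔ InLong H i β := by
  rw [← inSub_val, longT_val, ← inLong_sgn_mul i]; rfl

theorem shortT_mem_iff {i j : Idx n} (hij : j ≠ i) (hij' : j ≠ neg i) {ξ : R} :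
    shortT i j hij hij' ξ ∈ H ↔ InRoot H i (neg j) ξ := by
  have h : neg j ≠ neg i := neg_ne_neg_iff.2 hij
  rw [← inSub_val, shortT_val, ← inRoot_sgn_mul h j]
  exact ⟨fun h' => InRoot.of_neg h h', fun h' => InRoot.neg_param h h'⟩

theorem shortT_mulVec_bv {i j : Idx n} (hij : j ≠ i) (hij' : j ≠ neg i) (ξ : R) {a : Idx n}
    (h1 : a ≠ j) (h2 : a ≠ neg i) : (shortT i j hij hij' ξ).1 *ᵥ bv R a = bv R a := by
  rw [shortT_mulVec]
  simp [h1.symm, h2.symm]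

/-- The case `a = c` is allowed: the result is then a long root element with doubled parameter
(`inLong_two_mul`). -/
theorem InRoot.comm {a b c : Idx n} (hab : a ≠ b) (hab' : a ≠ neg b) (hcb : c ≠ b)
    (hcb' : c ≠ neg b) (hac : a ≠ neg c) {ξ ζ : R} (h : InRoot H a b ξ)
    (h' : InRoot H c (neg b) ζ) : InRoot H a c (ξ * ζ) := by
  have hbc : b ≠ neg c := ne_neg_comm.1 hcb'
  have ht := (shortT_mem_iff hcb.symm hbc).2 h'
  have := h.heis_commutator (sharp_bv_smul (ne_neg_comm.1 hab') ξ) ht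
    (shortT_mulVec_bv _ _ _ hab hac)
  have e : (shortT c b hcb.symm hbc ζ).1 *ᵥ (ξ • bv R b) = ξ • bv R b + (ξ * ζ) • bv R c := by
    rw [shortT_mulVec]
    simp [hbc.symm, mul_comm]
  rw [e, add_sub_cancel_left, sharp_add, add_dotProduct, sharp_dotProduct_self, sharp_smul,
    smul_dotProduct, sharp_bv_smul hbc, smul_zero, add_zero, neg_zero] at this
  exact this

theorem InLong.comm {b c : Idx n} (hcb : c ≠ b) (hcb' : c ≠ neg b) {β ζ : R} (h : InLong H b β)
    (h' : InRoot H c (neg b) ζ) :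
    InSub H (heis (bv R c) ((β * ζ) • bv R b) (β * ζ ^ 2)) := by
  have hbc : b ≠ neg c := ne_neg_comm.1 hcb'
  have ht := (shortT_mem_iff hcb.symm hbc).2 h'
  have h1 := InSub.heis_conj h ht
  have e : (shortT c b hcb.symm hbc ζ).1 *ᵥ (bv R b) = bv R b + ζ • bv R c := by
    rw [shortT_mulVec]
    simp [hbc.symm]
  have e0 : heis (ζ • bv R c) (β • bv R b) β = heis (bv R c) ((β * ζ) • bv R b) (β * ζ ^ 2) := by
    simp only [heis, sharp_smul, smul_vecMulVec, vecMulVec_smul, smul_smul]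
    rw [mul_comm ζ β, sq]
  rw [mulVec_zero, e] at h1
  have h2 := h1.mul h.neg_param
  rwa [heis_add_mul _ _ _ (sharp_bv_smul hcb' ζ), e0] at h2

/-- Separating the short root part of an element of the unipotent radical. -/
theorem InSub.inRoot_of_heis {i : Idx n} {v : Idx n → R} {β : R} (h : InSub H (heis (bv R i) v β))
    (hv : v (neg i) = 0) {p q f : Idx n} (hpq : p ≠ q) (hpq' : p ≠ neg q)
    (hfp : f ≠ p) (hfp' : f ≠ neg p) (hfq : f ≠ q) (hqi : q ≠ i) (hpi : p ≠ i)
    (hpi' : p ≠ neg i) (hfi : f ≠ neg i)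
    (h1 : InRoot H p (neg q) 1) (h2 : InRoot H f (neg p) 1) :
    InRoot H i f (v q) := by
  have hqp := ne_neg_comm.1 hpq'
  have hpf := ne_neg_comm.1 hfp'
  have ht1 := (shortT_mem_iff hpq.symm hqp).2 h1
  have ht2 := (shortT_mem_iff hfp.symm hpf).2 h2
  -- The commutator with `T_{pq}(1)` leaves only `v_q e_p` and a multiple of `e_{-q}`; the one with
  -- `T_{fp}(1)` then sees only the former and leaves exactly `v_q e_f`, with no quadratic term.
  have c1 := h.heis_commutator (by rw [sharp_bv_dotProduct, hv, mul_zero]) ht1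
    (shortT_mulVec_bv _ _ _ hqi.symm (ne_neg_comm.1 hpi'))
  set w := (shortT p q hpq.symm hqp (1 : R)).1 *ᵥ v - v with hw
  have ew : ∀ j, w j = (if j = p then v q else 0) -
      (if j = neg q then sgn R p * sgn R q * v (neg p) else 0) := by
    intro j
    rw [hw, shortT_mulVec]
    simp only [Pi.sub_apply, Pi.add_apply, Pi.smul_apply, Pi.single_apply, smul_eq_mul]
    split_ifs <;> ring
  have hwi : w (neg i) = 0 := by
    rw [ew, if_neg hpi'.symm, if_neg (neg_ne_neg_iff.2 hqi.symm), sub_zero]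
  have hwf : w (neg f) = 0 := by
    rw [ew, if_neg (neg_ne_iff.2 hfp'), if_neg (neg_ne_neg_iff.2 hfq), sub_zero]
  have hwp : w p = v q := by
    rw [ew, if_pos rfl, if_neg hpq', sub_zero]
  have c2 := c1.heis_commutator (by rw [sharp_bv_dotProduct, hwi, mul_zero]) ht2
    (shortT_mulVec_bv _ _ _ hpi.symm (ne_neg_comm.1 hfi))
  have e : (shortT f p hfp.symm hpf (1 : R)).1 *ᵥ w = w + v q • bv R f := by
    rw [shortT_mulVec, hwf, hwp]; simp
  rw [e, add_sub_cancel_left, sharp_add, add_dotProduct, sharp_dotProduct_self, sharp_smul,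
    smul_dotProduct, sharp_bv_dotProduct, hwf, mul_zero, smul_zero, add_zero, neg_zero] at c2
  exact c2

end Membership

/-! ### Combinatorial consequences of the bound on class sizes. -/

section LargeRelations

variable {n : ℕ} {R : Type*} [CommRing R]

/-- The combinatorial content of the condition `h(ν) ≥ (4,5)` for a unitary relation `ν`. -/
structure IsLargeRel (ν : Setoid (Idx n)) : Prop where
  neg_rel : ∀ {i j}, ν i j → ν (neg i) (neg j)
  exists_of_self : ∀ {i}, ν i (neg i) → ∃ h, ν i h ∧ h ≠ i ∧ h ≠ neg i
  exists_of_not_self : ∀ {i}, ¬ ν i (neg i) → ∀ S : Finset (Idx n), S.card ≤ 4 →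
    ∃ m, ν i m ∧ m ∉ S

theorem isLargeRel_of_minSizes {ν : Setoid (Idx n)} (hν : IsUnitaryRel ν)
    (hsize : ((4, 5) : ℕ∞ × ℕ∞) ≤ minSizes ν) : IsLargeRel ν := by
  have hcl : ∀ i, {x | ν x i} ∈ ν.classes := fun i => Setoid.mem_classes ν i
  have key : ∀ (C : Set (Idx n)) (S : Finset (Idx n)), (S.card : ℕ∞) < C.encard →
      ∃ m ∈ C, m ∉ S := by
    intro C S h
    by_contra hc
    push Not at hc
    have h1 : C ⊆ (S : Set (Idx n)) := fun x hx => hc x hx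
    have h2 := Set.encard_le_encard h1
    rw [Set.encard_coe_eq_coe_finsetCard] at h2
    exact absurd h (not_lt.2 h2)
  refine ⟨fun {i j} h => hν i j h, fun {i} hi => ?_, fun {i} hi S hS => ?_⟩
  · have hself : IsSelfConj {x | ν x i} := fun x hx =>
      ν.trans' (hν _ _ hx) (ν.symm' hi)
    have h4 : (4 : ℕ∞) ≤ Set.encard {x | ν x i} :=
      hsize.1.trans (iInf₂_le {x | ν x i} ⟨hcl i, hself⟩)
    obtain ⟨m, hm, hmS⟩ := key {x | ν x i} {i, neg i} (lt_of_lt_of_le (by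
      have : ({i, neg i} : Finset (Idx n)).card ≤ 2 := Finset.card_le_two
      exact_mod_cast lt_of_le_of_lt this (by norm_num)) h4)
    simp only [Finset.mem_insert, Finset.mem_singleton, not_or] at hmS
    exact ⟨m, ν.symm' hm, hmS⟩
  · have hself : ¬ IsSelfConj {x | ν x i} := fun h => hi (ν.symm' (h i (ν.refl' i)))
    have h5 : (5 : ℕ∞) ≤ Set.encard {x | ν x i} :=
      hsize.2.trans (iInf₂_le {x | ν x i} ⟨hcl i, hself⟩)
    obtain ⟨m, hm, hmS⟩ := key {x | ν x i} S (lt_of_lt_of_le (by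
      exact_mod_cast lt_of_le_of_lt hS (by norm_num)) h5)
    exact ⟨m, ν.symm' hm, hmS⟩

end LargeRelations

end SympNet

namespace SympNet

/-! ### The form net of all parameters occurring in `H`. -/

section LevelNet

open Matrix

variable {n : ℕ} {R : Type*} [CommRing R] {H : Subgroup (Sp n R)} {ν : Setoid (Idx n)}

namespace IsLargeRel

theorem neg_rel_iff (hν : IsLargeRel ν) {i j : Idx n} : ν (neg i) (neg j) ↔ ν i j :=
  ⟨fun h => by simpa [neg_neg] using hν.neg_rel h, hν.neg_rel⟩

theorem rel_neg_comm (hν : IsLargeRel ν) {i j : Idx n} : ν i (neg j) ↔ ν (neg i) j := by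
  rw [← hν.neg_rel_iff, neg_neg]

theorem self_of_rel (hν : IsLargeRel ν) {i j : Idx n} (h : ν i j) (hi : ν i (neg i)) :
    ν j (neg j) :=
  ν.trans' (ν.symm' h) (ν.trans' hi (hν.neg_rel h))

theorem exists_rel_ne (hν : IsLargeRel ν) (i : Idx n) : ∃ h, ν i h ∧ h ≠ i ∧ h ≠ neg i := by
  by_cases hi : ν i (neg i)
  · exact hν.exists_of_self hi
  · obtain ⟨m, hm, hmS⟩ := hν.exists_of_not_self hi {i, neg i}
      (Finset.card_le_two.trans (by norm_num))
    simp only [Finset.mem_insert, Finset.mem_singleton, not_or] at hmS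
    exact ⟨m, hm, hmS⟩

theorem exists_rel_ne' (hν : IsLargeRel ν) (j i : Idx n) : ∃ k, ν j k ∧ k ≠ i ∧ k ≠ neg i := by
  by_cases h1 : j = i
  · subst h1; exact hν.exists_rel_ne j
  by_cases h2 : j = neg i
  · subst h2
    obtain ⟨k, hk, hk1, hk2⟩ := hν.exists_rel_ne (neg i)
    exact ⟨k, hk, by rwa [neg_neg] at hk2, hk1⟩
  exact ⟨j, ν.refl' j, h1, h2⟩

theorem exists_rel_ne_ne (hν : IsLargeRel ν) {k l : Idx n} (hkl : ¬ ν k l) :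
    ∃ m, ν k m ∧ m ≠ k ∧ m ≠ neg k ∧ m ≠ l ∧ m ≠ neg l := by
  by_cases hk : ν k (neg k)
  · obtain ⟨h, hh, h1, h2⟩ := hν.exists_of_self hk
    refine ⟨h, hh, h1, h2, fun e => hkl (e ▸ hh), fun e => hkl ?_⟩
    subst e
    exact ν.trans' hk (hν.rel_neg_comm.1 hh)
  · obtain ⟨m, hm, hmS⟩ := hν.exists_of_not_self hk {k, neg k, l, neg l} Finset.card_le_four
    simp only [Finset.mem_insert, Finset.mem_singleton, not_or] at hmS
    exact ⟨m, hm, hmS.1, hmS.2.1, hmS.2.2⟩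

theorem exists_rel_avoid (hν : IsLargeRel ν) {k i j : Idx n} (hi : ¬ ν k i) (hj : ¬ ν k j) :
    ∃ m, ν k m ∧ m ≠ i ∧ m ≠ neg i ∧ m ≠ j ∧ m ≠ neg j := by
  by_cases hk : ν k (neg k)
  · have key : ∀ {l}, ¬ ν k l → k ≠ l ∧ k ≠ neg l := fun {l} hl => by
      refine ⟨fun e => hl (e ▸ ν.refl' k), fun e => hl ?_⟩
      have : l = neg k := by rw [e, neg_neg]
      rwa [this]
    exact ⟨k, ν.refl' k, (key hi).1, (key hi).2, key hj⟩
  · obtain ⟨m, hm, hmS⟩ := hν.exists_of_not_self hk {i, neg i, j, neg j} Finset.card_le_four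
    simp only [Finset.mem_insert, Finset.mem_singleton, not_or] at hmS
    exact ⟨m, hm, hmS⟩

end IsLargeRel

theorem inRoot_of_rel (hH : blockElem ν R ≤ H) {a b : Idx n} (hab : a ≠ b) (hab' : a ≠ neg b)
    (h : ν a (neg b)) (ξ : R) : InRoot H a b ξ := by
  have h2 : neg b ≠ neg a := neg_ne_neg_iff.2 hab.symm
  have := (shortT_mem_iff (H := H) hab'.symm h2 (ξ := ξ)).1
    (hH (Subgroup.subset_closure (Or.inr ⟨a, neg b, hab'.symm, h2, ξ, h, rfl⟩)))
  rwa [neg_neg] at this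

theorem inLong_of_rel (hH : blockElem ν R ≤ H) {a : Idx n} (h : ν a (neg a)) (β : R) :
    InLong H a β :=
  longT_mem_iff.1 (hH (Subgroup.subset_closure (Or.inl ⟨a, β, h, rfl⟩)))

/-- A commutator with the block root element on `c`, `-a` replaces `a` by `c`. -/
theorem InRoot.spread_left (hν : IsLargeRel ν) (hH : blockElem ν R ≤ H) {a b c : Idx n} {ξ : R}
    (h : InRoot H a b ξ) (hab : a ≠ b) (hab' : a ≠ neg b) (hn : ¬ ν a (neg b)) (hac : ν a c)
    (hcb : c ≠ b) (hcb' : c ≠ neg b) : InRoot H c b ξ := by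
  have step : ∀ {a c : Idx n}, InRoot H a b ξ → a ≠ b → a ≠ neg b → ν a c → c ≠ b → c ≠ neg b →
      c ≠ neg a → InRoot H c b ξ := by
    intro a c h hab hab' hac hcb hcb' hca
    by_cases e : c = a
    · rwa [e]
    have h1 := inRoot_of_rel hH (a := c) (b := neg a) hca (by rwa [neg_neg])
      (by rw [neg_neg]; exact ν.symm' hac) 1
    have := h.symm.comm hab.symm (ne_neg_comm.1 hab') e hca (ne_neg_comm.1 hcb') h1
    rw [mul_one] at this
    exact this.symm
  -- For `c = -a` the required block element would be long rather than short; the class is then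
  -- self-conjugate, and a detour through a third member of it works.
  by_cases e : c = neg a
  · subst e
    obtain ⟨k, hk, hk1, hk2⟩ := hν.exists_of_self hac
    have hkb : k ≠ b := fun e => hn (ν.trans' hac (hν.neg_rel (e ▸ hk)))
    have hkb' : k ≠ neg b := fun e => hn (e ▸ hk)
    refine step (step h hab hab' hk hkb hkb' hk2) hkb hkb' (ν.trans' (ν.symm' hk) hac) hcb hcb'
      (neg_ne_neg_iff.2 hk1.symm)
  · exact step h hab hab' hac hcb hcb' e

theorem InRoot.spread (hν : IsLargeRel ν) (hH : blockElem ν R ≤ H) {a b c d : Idx n} {ξ : R}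
    (h : InRoot H a b ξ) (hab : a ≠ b) (hab' : a ≠ neg b) (hac : ν a c) (hbd : ν b d)
    (hcd : c ≠ d) (hcd' : c ≠ neg d) : InRoot H c d ξ := by
  by_cases hn : ν a (neg b)
  · exact inRoot_of_rel hH hcd hcd' (ν.trans' (ν.symm' hac) (ν.trans' hn (hν.neg_rel hbd))) ξ
  have hnb : ¬ ν b (neg a) := fun h' => hn (ν.symm' (hν.rel_neg_comm.1 h'))
  have hba' := ne_neg_comm.1 hab'
  have hcb' : c ≠ neg b := fun e => hn (e ▸ hac)
  have hda' : d ≠ neg a := fun e => hnb (e ▸ hbd)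
  by_cases hcb : c = b
  · subst hcb
    by_cases hda : d = a
    · subst hda; exact h.symm
    · exact (h.symm.spread_left hν hH hab.symm hba' hnb hbd hda hda').symm.spread_left hν hH
        (Ne.symm hda) (ne_neg_comm.1 hda')
        (fun h' => hn (ν.trans' h' (hν.neg_rel (ν.symm' hbd)))) hac hcd hcd'
  · refine ((h.spread_left hν hH hab hab' hn hac hcb hcb').symm.spread_left hν hH
      (Ne.symm hcb) (ne_neg_comm.1 hcb') (fun h' => hnb ?_) hbd hcd.symm
      (ne_neg_comm.1 hcd')).symm
    exact ν.trans' h' (hν.neg_rel (ν.symm' hac))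

theorem InSub.inLong_of_inRoot {a b : Idx n} (hab : b ≠ neg a) {ξ β : R}
    (h : InSub H (heis (bv R a) (ξ • bv R b) β)) (h' : InRoot H a b ξ) : InLong H a β := by
  have h0 := sharp_bv_smul hab ξ
  have := h.heis_mul (h'.neg_param hab) h0 (sharp_bv_smul hab _)
  rwa [← add_smul, add_neg_cancel, zero_smul, neg_smul, dotProduct_neg, sharp_dotProduct_self,
    neg_zero, add_zero, add_zero] at this

theorem InSub.inRoot_of_inLong {a b : Idx n} (hab : b ≠ neg a) {ξ β : R}
    (h : InSub H (heis (bv R a) (ξ • bv R b) β)) (h' : InLong H a β) : InRoot H a b ξ := by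
  have := h.heis_mul h'.neg_param (sharp_bv_smul hab ξ) (dotProduct_zero _)
  rwa [add_zero, dotProduct_zero, add_zero, add_neg_cancel] at this

/-- Conjugating the long root element by a block transvection yields the wanted one at `c`
multiplied by a short factor on `c`, `a`. A third index of the class shows that this factor lies in
`H` by itself. -/
theorem InLong.spread (hν : IsLargeRel ν) (hH : blockElem ν R ≤ H) {a c : Idx n} {β : R}
    (h : InLong H a β) (hac : ν a c) : InLong H c β := by
  by_cases ha : ν a (neg a)
  · exact inLong_of_rel hH (hν.self_of_rel hac ha) β
  by_cases e : c = a
  · rwa [e]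
  have hca' : c ≠ neg a := fun e => ha (e ▸ hac)
  have hc : ¬ ν c (neg c) := fun h' => ha (hν.self_of_rel (ν.symm' hac) h')
  obtain ⟨m, hm, hmS⟩ := hν.exists_of_not_self ha {a, c} (Finset.card_le_two.trans (by norm_num))
  simp only [Finset.mem_insert, Finset.mem_singleton, not_or] at hmS
  have h1 := h.comm e hca' (inRoot_of_rel hH hca' (by rwa [neg_neg])
      (by rw [neg_neg]; exact ν.symm' hac) 1)
  rw [mul_one, one_pow, mul_one] at h1
  have hma : m ≠ neg a := fun e => ha (e ▸ hm)
  have hmc : m ≠ neg c := fun e => hc (ν.trans' (ν.symm' hac) (e ▸ hm))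
  -- the short factor is isolated by the block transvection `T_{ma}`
  have ht : shortT m a (Ne.symm hmS.1) (ne_neg_comm.1 hma) (1 : R) ∈ H :=
    (shortT_mem_iff _ _).2 (inRoot_of_rel hH hma (by rw [neg_neg]; exact hmS.1)
      (by rw [neg_neg]; exact ν.symm' hm) 1)
  have h2 := h1.heis_commutator (sharp_bv_smul (ne_neg_comm.1 hca') β) ht
    (shortT_mulVec_bv _ _ _ e (ne_neg_comm.1 hmc))
  have e2 : (shortT m a (Ne.symm hmS.1) (ne_neg_comm.1 hma) (1 : R)).1 *ᵥ (β • bv R a) =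
      β • bv R a + β • bv R m := by
    rw [shortT_mulVec]
    simp [neg_ne_iff.2 hma]
  rw [e2, add_sub_cancel_left, sharp_add, add_dotProduct, sharp_dotProduct_self, sharp_smul,
    smul_dotProduct, sharp_bv_smul (ne_neg_comm.1 hma), smul_zero, add_zero, neg_zero] at h2
  have h3 : InRoot H c m β := h2
  exact h1.inLong_of_inRoot (ne_neg_comm.1 hca') (h3.spread hν hH (Ne.symm hmS.2)
    (ne_neg_comm.1 hmc) (ν.refl' c) (ν.symm' hm) e hca')

/-- The components of the net of ideals of a subgroup `H`. -/
def levelIdeal (hν : IsLargeRel ν) (hH : blockElem ν R ≤ H) (i j : Idx n) : Ideal R where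
  carrier := {ξ | ∀ k l, ν i k → ν j l → k ≠ l → k ≠ neg l → InRoot H k (neg l) ξ}
  add_mem' := fun h h' k l hk hl hkl hkl' =>
    (h k l hk hl hkl hkl').add (neg_ne_neg_iff.2 hkl.symm) (h' k l hk hl hkl hkl')
  zero_mem' := fun k l _ _ _ _ => inRoot_zero H k (neg l)
  smul_mem' := by
    intro r ξ h k l hk hl hkl hkl'
    by_cases hr : ν k l
    · exact inRoot_of_rel hH hkl' (by rwa [neg_neg]) (by rwa [neg_neg]) _
    -- Multiplication by `r` is the commutator of `T_{ml}(ξ)` with the block transvection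
    -- `T_{km}(r)`, so `m` must avoid `±k` and `±l`.
    obtain ⟨m, hm, h1, h2, h3, h4⟩ := hν.exists_rel_ne_ne hr
    have h5 := (h m l (ν.trans' hk hm) hl h3 h4).symm
    have h6 := inRoot_of_rel hH (a := k) (b := neg m) (ne_neg_comm.1 h2)
      (by rw [neg_neg]; exact h1.symm) (by rwa [neg_neg]) r
    have := h5.comm h4.symm (neg_ne_neg_iff.2 h3.symm) h1.symm (ne_neg_comm.1 h2)
      (neg_ne_neg_iff.2 hkl.symm) h6
    rw [smul_eq_mul, mul_comm]
    exact this.symm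

/-- The components of the column of form parameters of a subgroup `H`. -/
def levelForm (H : Subgroup (Sp n R)) (ν : Setoid (Idx n)) (i : Idx n) : AddSubgroup R where
  carrier := {α | ∀ k, ν i k → InLong H k α}
  add_mem' := fun h h' k hk => (h k hk).add (h' k hk)
  zero_mem' := fun k _ => inLong_zero H k
  neg_mem' := fun h k hk => (h k hk).neg_param

theorem levelIdeal_mono {hν : IsLargeRel ν} {hH : blockElem ν R ≤ H} {i j i' j' : Idx n}
    (hi : ν i i') (hj : ν j j') : levelIdeal hν hH i j ≤ levelIdeal hν hH i' j' :=
  fun _ h k l hk hl => h k l (ν.trans' hi hk) (ν.trans' hj hl)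

theorem levelIdeal_mul_le (hν : IsLargeRel ν) (hH : blockElem ν R ≤ H) (i j k : Idx n) :
    levelIdeal hν hH i k * levelIdeal hν hH k j ≤ levelIdeal hν hH i j := by
  by_cases hik : ν i k
  · exact Ideal.mul_le_right.trans (levelIdeal_mono (ν.symm' hik) (ν.refl' j))
  by_cases hkj : ν k j
  · exact Ideal.mul_le_left.trans (levelIdeal_mono (ν.refl' i) hkj)
  rw [Ideal.mul_le]
  intro ξ hξ ζ hζ i' j' hi hj hij hij'
  obtain ⟨m, hm, h1, h2, h3, h4⟩ := hν.exists_rel_avoid (k := k) (i := i') (j := j')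
    (fun h => hik (ν.trans' hi (ν.symm' h))) (fun h => hkj (ν.trans' h (ν.symm' hj)))
  have h5 := hξ i' m hi hm h1.symm (ne_neg_comm.1 h2)
  have h6 := (hζ m j' hm hj h3 h4).symm
  exact h5.comm (ne_neg_comm.1 h2) (by rw [neg_neg]; exact h1.symm) (neg_ne_neg_iff.2 h3.symm)
    (by rw [neg_neg]; exact h4.symm) (by rwa [neg_neg]) (by rwa [neg_neg])

theorem levelForm_le (hν : IsLargeRel ν) (hH : blockElem ν R ≤ H) {i : Idx n} {α : R}
    (hα : α ∈ levelForm H ν i) : α ∈ levelIdeal hν hH i (neg i) := by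
  intro k l hk hl hkl hkl'
  have hl' : ν i (neg l) := hν.rel_neg_comm.2 hl
  have h1 := (hα (neg l) hl').comm (c := k) hkl' (by rwa [neg_neg])
    (by rw [neg_neg]; exact inRoot_of_rel hH hkl hkl' (ν.trans' (ν.symm' hk) hl') 1)
  rw [mul_one, one_pow, mul_one] at h1
  exact h1.inRoot_of_inLong (neg_ne_neg_iff.2 hkl.symm) (hα k hk)

/-- The form net of ideals of a subgroup `H` containing `Ep(ν, R)`. -/
def levelNet (hν : IsLargeRel ν) (hH : blockElem ν R ≤ H) : FormNet n R where
  σ := levelIdeal hν hH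
  Γ := levelForm H ν
  mul_le := levelIdeal_mul_le hν hH
  two_mul_mem := by
    intro i α hα k hk
    obtain ⟨h, hh, h1, h2⟩ := hν.exists_rel_ne k
    have h3 := hα k (neg h) hk (hν.neg_rel (ν.trans' hk hh)) (ne_neg_comm.1 h2)
      (by rw [neg_neg]; exact h1.symm)
    rw [neg_neg] at h3
    have h4 := inRoot_of_rel hH (a := k) (b := neg h) (ne_neg_comm.1 h2)
      (by rw [neg_neg]; exact h1.symm) (by rwa [neg_neg]) 1
    -- Both outer indices equal `k`, so this commutator is the long root element with parameter `2 *
    -- α`.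
    have := h3.comm h1.symm (ne_neg_comm.1 h2) h1.symm (ne_neg_comm.1 h2) (neg_ne k).symm h4
    rw [mul_one] at this
    exact inLong_two_mul.2 this
  mem_of_mem_form := fun i α hα => levelForm_le hν hH hα
  sq_mul_mem := by
    intro i j ξ hξ α hα k hk
    obtain ⟨m, hm, h1, h2⟩ := hν.exists_rel_ne' j k
    have h3 := (hα m hm).comm h1.symm (ne_neg_comm.1 h2) (hξ k m hk hm h1.symm (ne_neg_comm.1 h2))
    -- The commutator `h3` also has a short factor; its parameter lies in the level ideal, so it can
    -- be divided out.
    have h4 : ξ * α ∈ levelIdeal hν hH i (neg j) :=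
      levelIdeal_mul_le hν hH i (neg j) j (Ideal.mul_mem_mul hξ (levelForm_le hν hH hα))
    have h5 := h4 k (neg m) hk (hν.neg_rel hm) (ne_neg_comm.1 h2) (by rw [neg_neg]; exact h1.symm)
    rw [neg_neg, mul_comm] at h5
    rw [mul_comm]
    exact h3.inLong_of_inRoot h2 h5

theorem levelNet_isUnitary (hν : IsLargeRel ν) (hH : blockElem ν R ≤ H) :
    (levelNet hν hH).IsUnitary := by
  have key : ∀ i j, levelIdeal hν hH i j ≤ levelIdeal hν hH (neg j) (neg i) := by
    intro i j ξ hξ k l hk hl hkl hkl'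
    have := hξ (neg l) (neg k) (hν.rel_neg_comm.2 hl) (hν.rel_neg_comm.2 hk)
      (neg_ne_neg_iff.2 hkl.symm) (by rw [neg_neg]; exact hkl'.symm)
    rw [neg_neg] at this
    exact this.symm
  intro i j
  refine le_antisymm (key i j) ?_
  have := key (neg j) (neg i)
  rwa [neg_neg, neg_neg] at this

theorem one_mem_levelIdeal (hν : IsLargeRel ν) (hH : blockElem ν R ≤ H) {i j : Idx n}
    (h : ν i j) : (1 : R) ∈ levelIdeal hν hH i j := fun k l hk hl hkl hkl' =>
  inRoot_of_rel hH hkl' (by rwa [neg_neg])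
    (by rw [neg_neg]; exact ν.trans' (ν.symm' hk) (ν.trans' h hl)) 1

theorem levelNet_isDNet (hν : IsLargeRel ν) (hH : blockElem ν R ≤ H) :
    (levelNet hν hH).IsDNet := fun i =>
  (Ideal.eq_top_iff_one _).2 (one_mem_levelIdeal hν hH (ν.refl' i))

theorem levelNet_isExact (hν : IsLargeRel ν) (hH : blockElem ν R ≤ H) :
    (levelNet hν hH).IsExact := by
  intro i
  apply le_antisymm
  · obtain ⟨h, hh, h1, h2⟩ := hν.exists_rel_ne i
    refine le_trans ?_ le_sup_left
    refine le_trans ?_ (le_iSup₂_of_le h ⟨h1, h2⟩ le_rfl)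
    intro ξ hξ
    rw [← one_mul ξ]
    exact Ideal.mul_mem_mul (one_mem_levelIdeal hν hH hh)
      (levelIdeal_mono (hν := hν) (hH := hH) hh (ν.refl' _) hξ)
  · refine sup_le (iSup₂_le fun k _ => (levelNet hν hH).mul_le _ _ _) ?_
    rw [Ideal.span_le]
    exact fun α hα => levelForm_le hν hH hα

theorem levelNet_elem_le (hν : IsLargeRel ν) (hH : blockElem ν R ≤ H) :
    (levelNet hν hH).elem ≤ H := by
  rw [FormNet.elem, Subgroup.closure_le]
  rintro g (⟨i, j, hij, hij', ξ, hξ, rfl⟩ | ⟨i, α, hα, rfl⟩)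
  · exact (shortT_mem_iff hij hij').2
      (hξ i j (ν.refl' i) (ν.refl' j) hij.symm (ne_neg_comm.1 hij'))
  · exact longT_mem_iff.2 (hα i (ν.refl' i))

end LevelNet

end SympNet

namespace SympNet

/-! ### Reading off matrix entries from Heisenberg elements. -/

section Entries

open Matrix

variable {n : ℕ} {R : Type*} [CommRing R] {H : Subgroup (Sp n R)} {ν : Setoid (Idx n)}
  {N : FormNet n R}

/-- The properties of the form net associated with an overgroup `H` of `Ep(ν, R)` which are used
in the proof of the main theorem. -/
structure IsLevel (ν : Setoid (Idx n)) (H : Subgroup (Sp n R)) (N : FormNet n R) : Prop where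
  large : IsLargeRel ν
  block_le : blockElem ν R ≤ H
  unitary : N.IsUnitary
  mem_of_inRoot : ∀ {a b c d : Idx n} {ξ : R}, InRoot H a b ξ → a ≠ b → a ≠ neg b → ν a c →
    ν (neg b) d → ξ ∈ N.σ c d
  inRoot_of_mem : ∀ {i j : Idx n} {ξ : R}, ξ ∈ N.σ i j → j ≠ i → j ≠ neg i → InRoot H i (neg j) ξ
  mem_of_inLong : ∀ {a c : Idx n} {β : R}, InLong H a β → ν a c → β ∈ N.Γ c
  inLong_of_mem : ∀ {i : Idx n} {β : R}, β ∈ N.Γ i → InLong H i β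
  one_mem : ∀ {i j : Idx n}, ν i j → 1 ∈ N.σ i j

/-- Maximality gives `levelNet ≤ N`, so root elements of `H` have parameters in `N`; `N.elem ≤ H`
gives the converse. -/
theorem FormNet.IsAssociated.isLevel (hN : N.IsAssociated H) (hν : IsLargeRel ν)
    (hH : blockElem ν R ≤ H) : IsLevel ν H N := by
  obtain ⟨⟨hu, -, -, he⟩, hmax⟩ := hN
  have hle := hmax (levelNet hν hH) (levelNet_isUnitary hν hH) (levelNet_isDNet hν hH)
    (levelNet_isExact hν hH) (levelNet_elem_le hν hH)
  refine ⟨hν, hH, hu, ?_, ?_, ?_, ?_, fun h => hle.1 _ _ (one_mem_levelIdeal hν hH h)⟩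
  · intro a b c d ξ h hab hab' hac hbd
    refine hle.1 c d fun k l hk hl hkl hkl' => ?_
    exact h.spread hν hH hab hab' (ν.trans' hac hk) (hν.rel_neg_comm.2 (ν.trans' hbd hl)) hkl'
      (by rwa [neg_neg])
  · intro i j ξ h hij hij'
    exact (shortT_mem_iff hij hij').1
      (he (Subgroup.subset_closure (Or.inl ⟨i, j, hij, hij', ξ, h, rfl⟩)))
  · intro a c β h hac
    exact hle.2 c fun k hk => h.spread hν hH (ν.trans' hac hk)
  · intro i β h
    exact longT_mem_iff.1 (he (Subgroup.subset_closure (Or.inr ⟨i, β, h, rfl⟩)))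

namespace IsLevel

theorem mem_of_rel (hL : IsLevel ν H N) {i j : Idx n} (h : ν i j) (x : R) : x ∈ N.σ i j := by
  simpa using (N.σ i j).mul_mem_left x (hL.one_mem h)

theorem mono (hL : IsLevel ν H N) {i j i' j' : Idx n} {ξ : R} (h : ξ ∈ N.σ i j) (hi : ν i i')
    (hj : ν j j') : ξ ∈ N.σ i' j' := by
  have h1 := N.mul_le i' j i (Ideal.mul_mem_mul (hL.one_mem (ν.symm' hi)) h)
  have h2 := N.mul_le i' j' j (Ideal.mul_mem_mul h1 (hL.one_mem hj))
  simpa using h2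

theorem shortT_mem (hL : IsLevel ν H N) {i j : Idx n} {x : R} (hx : x ∈ N.σ i j) (hij : j ≠ i)
    (hij' : j ≠ neg i) : shortT i j hij hij' x ∈ H :=
  (shortT_mem_iff hij hij').2 (hL.inRoot_of_mem hx hij hij')

/-- `InSub.inRoot_of_heis` moves the coordinate at `q` to some `f ∼ q`. In a self-conjugate class,
where only four elements are guaranteed, `f = -q` serves, and such a class must avoid `i`. In any
other class five elements suffice to choose `p` and `f`. -/
theorem mem_of_heis (hL : IsLevel ν H N) {i q : Idx n} {v : Idx n → R} {β : R}
    (h : InSub H (heis (bv R i) v β)) (hv : v (neg i) = 0) (hqi : q ≠ i) (hqi' : q ≠ neg i)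
    (hq : ν q (neg q) → ¬ ν q i) : v q ∈ N.σ q (neg i) := by
  have hν := hL.large
  by_cases hself : ν q (neg q)
  · obtain ⟨p, hp, h1, h2⟩ := hν.exists_of_self hself
    have hpi : p ≠ i := fun e => hq hself (e ▸ hp)
    have hpi' : p ≠ neg i := fun e =>
      hq hself (ν.trans' hself (hν.rel_neg_comm.1 (e ▸ hp)))
    have r1 := hL.inRoot_of_mem (hL.mem_of_rel (ν.symm' hp) 1) h1.symm (ne_neg_comm.1 h2)
    have r2 := hL.inRoot_of_mem (i := neg q) (hL.mem_of_rel (ν.trans' (ν.symm' hself) hp) 1) h2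
      (by rwa [neg_neg])
    have := h.inRoot_of_heis hv h1 h2 h2.symm (neg_ne_neg_iff.2 h1.symm) (neg_ne q) hqi hpi hpi'
      (neg_ne_neg_iff.2 hqi) r1 r2
    exact hL.mem_of_inRoot this.symm (neg_ne_iff.2 hqi') (neg_ne_neg_iff.2 hqi) (ν.symm' hself)
      (ν.refl' _)
  · obtain ⟨p, hp, hpS⟩ := hν.exists_of_not_self hself {q, i, neg i}
      (Finset.card_le_three.trans (by norm_num))
    obtain ⟨f, hf, hfS⟩ := hν.exists_of_not_self hself {q, p, i, neg i} Finset.card_le_four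
    simp only [Finset.mem_insert, Finset.mem_singleton, not_or] at hpS hfS
    obtain ⟨h1, h2, h3⟩ := hpS
    obtain ⟨h4, h5, h6, h7⟩ := hfS
    have hpq : p ≠ neg q := fun e => hself (e ▸ hp)
    have hfp : f ≠ neg p := fun e =>
      hself (hν.self_of_rel (ν.symm' hp) (ν.trans' (ν.symm' hp) (e ▸ hf)))
    have r1 := hL.inRoot_of_mem (hL.mem_of_rel (ν.symm' hp) 1) (Ne.symm h1) (ne_neg_comm.1 hpq)
    have r2 := hL.inRoot_of_mem (hL.mem_of_rel (ν.trans' (ν.symm' hf) hp) 1) (Ne.symm h5)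
      (ne_neg_comm.1 hfp)
    have := h.inRoot_of_heis hv h1 hpq h5 hfp h4 hqi h2 h3 h7 r1 r2
    exact hL.mem_of_inRoot this.symm h6 h7 (ν.symm' hf) (ν.refl' _)

theorem mulVec_bv (g : Sp n R) (r q : Idx n) : (g.1 *ᵥ bv R r) q = g.1 q r := by
  simp [mulVec]

/-- Conjugating the root element on `e_r`, `e_{-s}` by `g` gives data `g e_r`, `g e_{-s}`. The zeros
in column `r` make `T_{sk}` fix `g e_r`, while `g_{k,-s} = 0` and the unit let it move `g e_{-s}` by
exactly `x e_{-k}`. The commutator therefore has data `g e_r`, `x e_{-k}`, which may be exchanged.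
-/
theorem heis_of_zeros (hL : IsLevel ν H N) {g : Sp n R} (hg : g ∈ H) {r s k : Idx n}
    (hr : ¬ ν r (neg r)) (hs : ν r s) (hk : ν r k) (hsr : s ≠ r) (hks : k ≠ s)
    (h1 : g.1 k r = 0) (h2 : g.1 (neg s) r = 0) (h3 : g.1 k (neg s) = 0)
    (h4 : IsUnit (g.1 (neg s) (neg s))) (x : R) :
    InSub H (heis (bv R (neg k)) (x • (g.1 *ᵥ bv R r)) 0) := by
  have hν := hL.large
  have hns : ∀ {a b}, ν r a → ν r b → a ≠ neg b := fun {a b} ha hb e =>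
    hr (hν.self_of_rel (ν.symm' hb) (ν.trans' (ν.symm' hb) (e ▸ ha)))
  have c1 := (hL.inRoot_of_mem (hL.mem_of_rel hs 1) hsr (hns hs (ν.refl' r))).heis_conj hg
  rw [one_smul] at c1
  obtain ⟨d, hd⟩ := isUnit_iff_exists_inv.1 (((isUnit_sgn R s).mul (isUnit_sgn R k)).mul h4)
  have ht := hL.shortT_mem (hL.mem_of_rel (ν.trans' (ν.symm' hs) hk) (-(d * x))) hks (hns hk hs)
  have horth : sharp (g.1 *ᵥ bv R r) ⬝ᵥ (g.1 *ᵥ bv R (neg s)) = 0 := by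
    rw [sharp_mulVec_dotProduct]
    have := sharp_bv_smul (R := R) (neg_ne_neg_iff.2 hsr) 1
    rwa [one_smul] at this
  have c2 := c1.heis_commutator horth ht (by
    rw [shortT_mulVec, mulVec_bv, mulVec_bv, h1, h2]; simp)
  set w := g.1 *ᵥ bv R (neg s) with hw
  have e : (shortT s k hks (hns hk hs) (-(d * x))).1 *ᵥ w = w + x • bv R (neg k) := by
    rw [shortT_mulVec, hw, mulVec_bv, mulVec_bv, h3, mul_zero, zero_smul, add_zero,
      sub_eq_add_neg, ← neg_smul]
    congr 2
    linear_combination x * hd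
  rw [e, add_sub_cancel_left, sharp_add, add_dotProduct, sharp_dotProduct_self, sharp_smul,
    smul_dotProduct, sharp_bv_dotProduct, neg_neg, hw, mulVec_bv, h3, mul_zero, smul_zero, add_zero,
    neg_zero, heis_comm, heis_smul_left] at c2
  exact c2

theorem mem_of_zeros (hL : IsLevel ν H N) {g : Sp n R} (hg : g ∈ H) {r s k q : Idx n}
    (hr : ¬ ν r (neg r)) (hs : ν r s) (hk : ν r k) (hsr : s ≠ r) (hks : k ≠ s)
    (h1 : g.1 k r = 0) (h2 : g.1 (neg s) r = 0) (h3 : g.1 k (neg s) = 0)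
    (h4 : IsUnit (g.1 (neg s) (neg s))) (hqk : q ≠ k) (hqk' : q ≠ neg k)
    (hq : ν q (neg q) → ¬ ν q r) : g.1 q r ∈ N.σ q r := by
  have hν := hL.large
  have c := hL.heis_of_zeros hg hr hs hk hsr hks h1 h2 h3 h4 1
  rw [one_smul] at c
  have := hL.mem_of_heis c (q := q) (by rw [neg_neg, mulVec_bv, h1]) hqk' (by rwa [neg_neg])
    (fun hqq h => hq hqq (ν.trans' hqq
      (ν.trans' (hν.rel_neg_comm.1 h) (ν.symm' hk))))
  rw [neg_neg, mulVec_bv] at this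
  exact hL.mono this (ν.refl' q) (ν.symm' hk)

/-- Since `r ∼ -r`, a long root element at `e_r` is available. Its conjugate by `g` has direction `g
e_r`; comparing it with its translate of direction `g e_r + e_h` produces mixed data `e_h`, `g e_r`,
from which entries can be read. -/
theorem mem_of_self (hL : IsLevel ν H N) {g : Sp n R} (hg : g ∈ H) {r q : Idx n}
    (hr : ν r (neg r)) (hu : IsUnit (g.1 r r)) (hq : ¬ ν q r) : g.1 q r ∈ N.σ q r := by
  have hν := hL.large
  obtain ⟨h, hh, h1, h2⟩ := hν.exists_of_self hr
  obtain ⟨d, hd⟩ := isUnit_iff_exists_inv.1 hu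
  have hqh : q ≠ h := fun e => hq (e ▸ ν.symm' hh)
  have hqh' : q ≠ neg h := fun e => hq (e ▸ ν.trans' (hν.neg_rel (ν.symm' hh)) (ν.symm' hr))
  have hqr' : q ≠ neg r := fun e => hq (e ▸ ν.symm' hr)
  have hrh : ν (neg h) r := ν.trans' (hν.neg_rel (ν.symm' hh)) (ν.symm' hr)
  have hr1 : r ≠ neg h := ne_neg_comm.1 h2
  have hr2 : r ≠ neg (neg h) := by rw [neg_neg]; exact h1.symm
  -- Clearing the entry at `(-h, r)` makes the new column orthogonal to `e_h` without changing its
  -- entries at `q` and `r`.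
  have hg1 := H.mul_mem (hL.shortT_mem (hL.mem_of_rel hrh (-(d * g.1 (neg h) r))) hr1 hr2) hg
  set g1 := shortT (neg h) r hr1 hr2 (-(d * g.1 (neg h) r)) * g with hg1'
  have e1 : g1.1 (neg h) r = 0 := by
    rw [hg1', shortT_mul_apply, if_pos rfl, if_neg (neg_ne_neg_iff.2 h1)]
    linear_combination (-g.1 (neg h) r) * hd
  have e2 : g1.1 r r = g.1 r r := by
    rw [hg1', shortT_mul_apply, if_neg hr1, if_neg (neg_ne r).symm, add_zero, sub_zero]
  have e3 : g1.1 q r = g.1 q r := by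
    rw [hg1', shortT_mul_apply, if_neg hqh', if_neg hqr', add_zero, sub_zero]
  have c1 := InSub.heis_conj (inLong_of_rel hL.block_le hr 1) hg1
  rw [mulVec_zero] at c1
  have ht := hL.shortT_mem (hL.mem_of_rel (ν.symm' hh) d) h1.symm (ne_neg_comm.1 h2)
  have c2 := c1.heis_conj ht
  have e : (shortT h r h1.symm (ne_neg_comm.1 h2) d).1 *ᵥ (g1.1 *ᵥ bv R r) =
      g1.1 *ᵥ bv R r + bv R h := by
    rw [shortT_mulVec, mulVec_bv, mulVec_bv, e1, e2, mul_comm d, hd]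
    simp
  rw [mulVec_zero, e] at c2
  have c3 := c1.heis_neg (dotProduct_zero _)
  rw [neg_zero] at c3
  have c4 := c2.mul c3
  rw [heis_add_mul _ _ _ (by
    rw [sharp_dotProduct_comm, sharp_bv_dotProduct, mulVec_bv, e1, mul_zero, neg_zero]),
    one_smul] at c4
  have := hL.mem_of_heis c4 (q := q) (by rw [mulVec_bv, e1]) hqh hqh'
    (fun _ h' => hq (ν.trans' h' (ν.symm' hh)))
  rw [mulVec_bv, e3] at this
  exact hL.mono this (ν.refl' q) hrh

end IsLevel

end Entries

end SympNet

namespace SympNet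

/-! ### Entries of matrices congruent to the identity modulo the radical. -/

section Jacobson

open Matrix

variable {n : ℕ} {R : Type*} [CommRing R] {H : Subgroup (Sp n R)} {ν : Setoid (Idx n)}
  {N : FormNet n R}

theorem isUnit_of_sub_one_mem_jacobson {x : R} (h : x - 1 ∈ Ring.jacobson R) : IsUnit x := by
  rw [← Ideal.jacobson_bot, Ideal.mem_jacobson_bot] at h
  simpa using h 1

/-- The part of `H` which is congruent to the identity modulo the Jacobson radical. -/
abbrev radicalPart (H : Subgroup (Sp n R)) : Subgroup (Sp n R) :=
  H ⊓ congruenceSubgroup n (Ring.jacobson R)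

theorem mem_jacobson_of_mem {g : Sp n R} (hg : g ∈ radicalPart H) {i j : Idx n} (h : i ≠ j) :
    g.1 i j ∈ Ring.jacobson R := by
  have := mem_congruenceSubgroup.1 hg.2 i j
  rwa [one_apply_ne h, sub_zero] at this

theorem isUnit_diag {g : Sp n R} (hg : g ∈ radicalPart H) (i : Idx n) : IsUnit (g.1 i i) := by
  have := mem_congruenceSubgroup.1 hg.2 i i
  rw [one_apply_eq] at this
  exact isUnit_of_sub_one_mem_jacobson this

theorem shortT_mem_congruenceSubgroup {J : Ideal R} {i j : Idx n} (hij : j ≠ i)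
    (hij' : j ≠ neg i) {x : R} (hx : x ∈ J) : shortT i j hij hij' x ∈ congruenceSubgroup n J := by
  rw [mem_congruenceSubgroup]
  intro a b
  have := shortT_mul_apply i j hij hij' x 1 a b
  rw [mul_one] at this
  rw [this]
  have e : ((1 : Sp n R)).1 a b = (1 : Matrix (Idx n) (Idx n) R) a b := rfl
  rw [e, add_sub_assoc, add_sub_cancel_left]
  refine J.sub_mem ?_ ?_
  · split_ifs
    · exact J.mul_mem_right _ hx
    · exact J.zero_mem
  · split_ifs
    · exact J.mul_mem_right _ (J.mul_mem_left _ hx)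
    · exact J.zero_mem

namespace IsLevel

/-- The coefficient `-g_{ij} / g_{jj}` lies both in `σ_{ij}` and in the radical, so the cleared
matrix stays in the radical part of `H`. -/
theorem exists_clear (hL : IsLevel ν H N) {g : Sp n R} (hg : g ∈ radicalPart H) {i j : Idx n}
    (hij : j ≠ i) (hij' : j ≠ neg i) (h : g.1 i j ∈ N.σ i j) :
    ∃ g' ∈ radicalPart H, ∃ x ∈ N.σ i j, g' = shortT i j hij hij' x * g ∧ g'.1 i j = 0 ∧
      g.1 i j + x * g.1 j j = 0 ∧ (∀ b, g'.1 i b = g.1 i b + x * g.1 j b) ∧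
      ∀ a b, a ≠ i → a ≠ neg j → g'.1 a b = g.1 a b := by
  obtain ⟨d, hd⟩ := isUnit_iff_exists_inv.1 (isUnit_diag hg j)
  have hx : -d * g.1 i j ∈ N.σ i j := (N.σ i j).mul_mem_left _ h
  have e1 : g.1 i j + -d * g.1 i j * g.1 j j = 0 := by linear_combination (-g.1 i j) * hd
  have e2 : ∀ b, (shortT i j hij hij' (-d * g.1 i j) * g).1 i b =
      g.1 i b + -d * g.1 i j * g.1 j b := by
    intro b
    rw [shortT_mul_apply, if_pos rfl, if_neg (ne_neg_comm.1 hij'), sub_zero]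
  refine ⟨_, mul_mem ⟨hL.shortT_mem hx hij hij', shortT_mem_congruenceSubgroup hij hij' ?_⟩ hg,
    _, hx, rfl, by rw [e2, e1], e1, e2, fun a b h1 h2 => ?_⟩
  · exact Ideal.mul_mem_left _ _ (mem_jacobson_of_mem hg hij.symm)
  · rw [shortT_mul_apply, if_neg h1, if_neg h2, add_zero, sub_zero]

theorem heis_apply (u w : Idx n → R) (x y : Idx n) :
    heis u w 0 x y = (1 : Matrix (Idx n) (Idx n) R) x y - sgn R y * (u x * w (neg y)) -
      sgn R y * (w x * u (neg y)) := by
  simp [heis, vecMulVec_apply, sharp]; ring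

/-- The argument of `mem_of_zeros` on `g` itself would need a zero in the opposite block, whose
entries are not yet known to be clearable. It is applied instead to `z = g T g⁻¹` with `T` a block
root element: each entry of `z` off the identity is bilinear in columns `r` and `-s` of `g`, and the
assumed zeros force the required ones. -/
theorem mem_opp_of_zeros (hL : IsLevel ν H N) {g : Sp n R} (hg : g ∈ radicalPart H)
    {r s a b k : Idx n} (hr : ¬ ν r (neg r)) (hs : ν r s) (ha : ν r a) (hb : ν r b) (hk : ν r k)
    (hsr : s ≠ r) (hsa : s ≠ a) (hsk : s ≠ k) (hab : a ≠ b) (hak : a ≠ k)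
    (hbk : b ≠ k) (h1 : g.1 k r = 0) (h2 : g.1 a r = 0) (h3 : g.1 b r = 0)
    (h4 : g.1 (neg a) (neg s) = 0) (h5 : g.1 (neg b) (neg s) = 0) :
    g.1 (neg a) r ∈ N.σ (neg a) r := by
  have hν := hL.large
  have hns : ∀ {a b}, ν r a → ν r b → a ≠ neg b := fun {a b} ha hb e =>
    hr (hν.self_of_rel (ν.symm' hb) (ν.trans' (ν.symm' hb) (e ▸ ha)))
  have hna : ¬ ν a (neg a) := fun h => hr (hν.self_of_rel (ν.symm' ha) h)
  obtain ⟨z, hz, ez⟩ := (hL.inRoot_of_mem (hL.mem_of_rel hs 1) hsr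
    (hns hs (ν.refl' r))).heis_conj hg.1
  rw [one_smul] at ez
  have hzz : ∀ x y, z.1 x y = (1 : Matrix (Idx n) (Idx n) R) x y -
      sgn R y * (g.1 x r * g.1 (neg y) (neg s)) - sgn R y * (g.1 x (neg s) * g.1 (neg y) r) := by
    intro x y
    rw [ez, heis_apply, mulVec_bv, mulVec_bv, mulVec_bv, mulVec_bv]
  have hneg : ∀ {x y}, ν r x → ν r y → neg x ≠ y := fun hx hy =>
    neg_ne_iff.2 (hns hx hy)
  have uaa : IsUnit (z.1 a a) := by
    apply isUnit_of_sub_one_mem_jacobson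
    rw [hzz, h2, h4, one_apply_eq]
    have := mem_jacobson_of_mem hg (i := neg a) (j := r) (hneg ha (ν.refl' r))
    convert Ideal.mul_mem_left _ (-(sgn R a * g.1 a (neg s))) this using 1
    ring
  have ubb : IsUnit (z.1 (neg b) (neg b)) := by
    apply isUnit_of_sub_one_mem_jacobson
    rw [hzz, neg_neg, h3, h5, one_apply_eq]
    have := mem_jacobson_of_mem hg (i := neg b) (j := r) (hneg hb (ν.refl' r))
    convert Ideal.mul_mem_left _ (-(sgn R (neg b) * g.1 b (neg s))) this using 1
    ring
  obtain ⟨d, hd⟩ := isUnit_iff_exists_inv.1 uaa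
  have hka : ν k a := ν.trans' (ν.symm' hk) ha
  -- The only missing zero, at `(k, a)`, is produced by a block transvection; `z` need not lie in
  -- the congruence subgroup, but its entry at `(a, a)` is a unit.
  have hz1 := H.mul_mem (hL.shortT_mem (hL.mem_of_rel hka (-(d * z.1 k a))) hak (hns ha hk)) hz
  set z1 := shortT k a hak (hns ha hk) (-(d * z.1 k a)) * z with hz1'
  have := hL.mem_of_zeros hz1 (r := a) (s := b) (k := k) (q := neg s) hna
    (ν.trans' (ν.symm' ha) hb) (ν.symm' hka) hab.symm hbk.symm ?_ ?_ ?_ ?_ (hneg hs hk)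
    (neg_ne_neg_iff.2 hsk) ?_
  · rw [hz1', shortT_mul_apply, if_neg (hneg hs hk), if_neg (neg_ne_neg_iff.2 hsa), hzz, h4,
      one_apply_ne (hneg hs ha)] at this
    -- What has been read off is `z_{-s,a} = -ε_a g_{-s,-s} g_{-a,r}`, a unit multiple of the wanted
    -- entry.
    obtain ⟨c, hc⟩ := isUnit_iff_exists_inv.1 ((isUnit_sgn R a).mul (isUnit_diag hg (neg s)))
    refine hL.mono (i := neg s) (j := a) ?_ (hν.neg_rel (ν.trans' (ν.symm' hs) ha)) (ν.symm' ha)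
    convert Ideal.mul_mem_left _ (-c) this using 1
    linear_combination (-g.1 (neg a) r) * hc
  · rw [hz1', shortT_mul_apply, if_pos rfl, if_neg (hns hk ha)]
    linear_combination (-z.1 k a) * hd
  · rw [hz1', shortT_mul_apply, if_neg (hneg hb hk), if_neg (neg_ne_neg_iff.2 hab.symm), hzz, h4,
      h5, one_apply_ne (hneg hb ha)]
    ring
  · rw [hz1', shortT_mul_apply, if_pos rfl, if_neg (hns hk ha), hzz k (neg b), hzz a (neg b), neg_neg,
      h1, h3, h2, one_apply_ne (hns hk hb), one_apply_ne (hns ha hb)]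
    ring
  · rw [hz1', shortT_mul_apply, if_neg (hneg hb hk), if_neg (neg_ne_neg_iff.2 hab.symm), add_zero,
      sub_zero]
    exact ubb
  · rw [neg_neg]
    exact fun h => (hr (hν.self_of_rel (ν.symm' hs) (ν.symm' h))).elim

/-- Five distinct indices `r`, `s`, `a`, `b`, `k` of one class allow all zeros of `mem_opp_of_zeros`
to be created by block transvections, whose coefficients are always in σ. Only the clearing at `(-a,
-s)` alters `g_{-a,r}`, by a multiple of `g_{-s,r}`; multiplying by `g_{-s,-s}` gives the minor. -/
theorem minor_mem (hL : IsLevel ν H N) {g : Sp n R} (hg : g ∈ radicalPart H)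
    {r s a : Idx n} (hr : ¬ ν r (neg r)) (hs : ν r s) (ha : ν r a) (hsr : s ≠ r) (har : a ≠ r)
    (hsa : s ≠ a) :
    g.1 (neg s) (neg s) * g.1 (neg a) r - g.1 (neg a) (neg s) * g.1 (neg s) r ∈
      N.σ (neg a) r := by
  have hν := hL.large
  have hns : ∀ {a b}, ν r a → ν r b → a ≠ neg b := fun {a b} ha hb e =>
    hr (hν.self_of_rel (ν.symm' hb) (ν.trans' (ν.symm' hb) (e ▸ ha)))
  have hneg : ∀ {x y}, ν r x → ν r y → neg x ≠ y := fun hx hy =>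
    neg_ne_iff.2 (hns hx hy)
  have hσ : ∀ {a b} (x : R), ν r a → ν r b → x ∈ N.σ a b := fun x ha hb =>
    hL.mem_of_rel (ν.trans' (ν.symm' ha) hb) x
  have hσ' : ∀ {a b} (x : R), ν r a → ν r b → x ∈ N.σ (neg a) (neg b) := fun x ha hb =>
    hL.mem_of_rel (hν.neg_rel (ν.trans' (ν.symm' ha) hb)) x
  have hrr := ν.refl' r
  obtain ⟨b, hb, hbS⟩ := hν.exists_of_not_self hr {r, s, a}
    (Finset.card_le_three.trans (by norm_num))
  obtain ⟨k, hk, hkS⟩ := hν.exists_of_not_self hr {r, s, a, b} Finset.card_le_four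
  simp only [Finset.mem_insert, Finset.mem_singleton, not_or] at hbS hkS
  obtain ⟨hbr, hbs, hba⟩ := hbS
  obtain ⟨hkr, hks, hka, hkb⟩ := hkS
  have nn : ∀ {x y : Idx n}, x ≠ y → neg x ≠ neg y := fun h => neg_ne_neg_iff.2 h
  obtain ⟨g1, hg1, -, -, -, z1, -, -, f1⟩ := hL.exists_clear hg (i := a) (j := r) (Ne.symm har)
    (hns hrr ha) (hσ _ ha hrr)
  obtain ⟨g2, hg2, -, -, -, z2, -, -, f2⟩ := hL.exists_clear hg1 (i := b) (j := r) (Ne.symm hbr)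
    (hns hrr hb) (hσ _ hb hrr)
  obtain ⟨g3, hg3, -, -, -, z3, -, -, f3⟩ := hL.exists_clear hg2 (i := k) (j := r) (Ne.symm hkr)
    (hns hrr hk) (hσ _ hk hrr)
  obtain ⟨g4, hg4, x, -, -, z4, e4, r4, f4⟩ := hL.exists_clear hg3 (i := neg a) (j := neg s)
    (nn hsa) (by rw [neg_neg]; exact hneg hs ha) (hσ' _ ha hs)
  obtain ⟨g5, hg5, -, -, -, z5, -, -, f5⟩ := hL.exists_clear hg4 (i := neg b) (j := neg s)
    (nn (Ne.symm hbs)) (by rw [neg_neg]; exact hneg hs hb) (hσ' _ hb hs)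
  simp only [neg_neg] at f4 f5
  have f : ∀ y c, ν r y → y ≠ r → g3.1 (neg y) c = g.1 (neg y) c := fun y c hy hyr => by
    rw [f3 _ _ (hneg hy hk) (nn hyr), f2 _ _ (hneg hy hb) (nn hyr),
      f1 _ _ (hneg hy ha) (nn hyr)]
  have f' : ∀ y c, ν r y → y ≠ s → g5.1 y c = g3.1 y c := fun y c hy hys => by
    rw [f5 _ _ (hns hy hb) hys, f4 _ _ (hns hy ha) hys]
  have key := hL.mem_opp_of_zeros hg5 hr hs ha hb hk hsr hsa (Ne.symm hks)
    (Ne.symm hba) (Ne.symm hka) (Ne.symm hkb) (by rw [f' _ _ hk hks, z3])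
    (by rw [f' _ _ ha hsa.symm, f3 _ _ (Ne.symm hka) (hns ha hrr),
      f2 _ _ (Ne.symm hba) (hns ha hrr), z1])
    (by rw [f' _ _ hb hbs, f3 _ _ (Ne.symm hkb) (hns hb hrr), z2])
    (by rw [f5 _ _ (nn (Ne.symm hba)) (hneg ha hs), z4]) z5
  rw [f5 _ _ (nn (Ne.symm hba)) (hneg ha hs), r4, f _ _ ha har, f _ _ hs hsr] at key
  rw [f _ _ ha har, f _ _ hs hsr] at e4
  convert Ideal.mul_mem_left _ (g.1 (neg s) (neg s)) key using 1
  linear_combination (-g.1 (neg s) r) * e4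

/-- The minors for `(s, a)` and `(a, s)` are two linear equations in `g_{-a,r}` and `g_{-s,r}`; the
determinant is 1 modulo the radical, so Cramer's rule applies. -/
theorem mem_opp_of_ne (hL : IsLevel ν H N) {g : Sp n R} (hg : g ∈ radicalPart H)
    {r a : Idx n} (hr : ¬ ν r (neg r)) (ha : ν r a) (har : a ≠ r) :
    g.1 (neg a) r ∈ N.σ (neg a) r := by
  have hν := hL.large
  obtain ⟨s, hs, hsS⟩ := hν.exists_of_not_self hr {r, a} (Finset.card_le_two.trans (by norm_num))
  simp only [Finset.mem_insert, Finset.mem_singleton, not_or] at hsS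
  obtain ⟨hsr, hsa⟩ := hsS
  have m1 := hL.minor_mem hg hr hs ha hsr har hsa
  have m2 := hL.mono (hL.minor_mem hg hr ha hs har hsr (Ne.symm hsa))
    (hν.neg_rel (ν.trans' (ν.symm' hs) ha)) (ν.refl' r)
  have hu : IsUnit (g.1 (neg s) (neg s) * g.1 (neg a) (neg a) -
      g.1 (neg a) (neg s) * g.1 (neg s) (neg a)) := by
    apply isUnit_of_sub_one_mem_jacobson
    have h1 := mem_congruenceSubgroup.1 hg.2 (neg s) (neg s)
    have h2 := mem_congruenceSubgroup.1 hg.2 (neg a) (neg a)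
    rw [one_apply_eq] at h1 h2
    have h3 := mem_jacobson_of_mem hg (neg_ne_neg_iff.2 hsa)
    convert Ideal.add_mem _ (Ideal.sub_mem _ (Ideal.mul_mem_left _ (g.1 (neg a) (neg a)) h1)
      (Ideal.mul_mem_left _ (g.1 (neg a) (neg s)) h3)) h2 using 1
    ring
  obtain ⟨d, hd⟩ := isUnit_iff_exists_inv.1 hu
  convert Ideal.mul_mem_left _ d (Ideal.add_mem _
    (Ideal.mul_mem_left _ (g.1 (neg a) (neg a)) m1)
    (Ideal.mul_mem_left _ (g.1 (neg a) (neg s)) m2)) using 1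
  linear_combination (-g.1 (neg a) r) * hd

theorem shortT_mul_shortT_neg {i j : Idx n} (hij : j ≠ i) (hij' : j ≠ neg i) (x : R) :
    shortT i j hij hij' x * shortT i j hij hij' (-x) = 1 := by
  apply Subtype.ext
  have h := sharp_bv_smul (R := R) (neg_ne_neg_iff.2 hij)
  show (shortT i j hij hij' x).1 * (shortT i j hij hij' (-x)).1 = 1
  have e : -(sgn R j * -x) = -(-(sgn R j * x)) := by ring
  rw [shortT_val, shortT_val, e, neg_smul (-(sgn R j * x)), heis_mul _ _ _ _ _ (h _)
    (by rw [dotProduct_neg, h, neg_zero]), add_neg_cancel, dotProduct_neg, sharp_dotProduct_self,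
    add_zero, neg_zero, add_zero, heis_zero]

theorem mem_opp (hL : IsLevel ν H N) {g : Sp n R} (hg : g ∈ radicalPart H)
    {r a : Idx n} (hr : ¬ ν r (neg r)) (ha : ν r a) :
    g.1 (neg a) r ∈ N.σ (neg a) r := by
  have hν := hL.large
  by_cases har : a = r
  swap
  · exact hL.mem_opp_of_ne hg hr ha har
  subst har
  obtain ⟨s, hs, hsa, hsa'⟩ := hν.exists_rel_ne a
  have has' : neg a ≠ neg (neg s) := by rw [neg_neg]; exact hsa'.symm
  -- conjugation by a block transvection moves the entry off the diagonal of the block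
  have hT := shortT_mul_shortT_neg (R := R) (i := neg s) (j := neg a) (neg_ne_neg_iff.2 hsa.symm)
    has' 1
  have ht := hL.shortT_mem (hL.mem_of_rel (hν.neg_rel (ν.symm' hs)) 1)
    (neg_ne_neg_iff.2 hsa.symm) has'
  set t := shortT (neg s) (neg a) (neg_ne_neg_iff.2 hsa.symm) has' (1 : R)
  have hti := (eq_inv_of_mul_eq_one_right hT)
  have hg' : t * g * t⁻¹ ∈ radicalPart H :=
    ⟨H.mul_mem (H.mul_mem ht hg.1) (H.inv_mem ht), by
      have : (congruenceSubgroup n (Ring.jacobson R)).Normal := MonoidHom.normal_ker _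
      exact this.conj_mem g hg.2 t⟩
  have hsn : ¬ ν s (neg s) := fun h => hr (hν.self_of_rel (ν.symm' hs) h)
  have k1 := hL.mem_opp_of_ne hg' hsn (ν.symm' hs) hsa.symm
  have k2 := hL.mem_opp_of_ne hg hsn (ν.symm' hs) hsa.symm
  have e : ∀ y, (t * g * t⁻¹).1 y s =
      (t * g).1 y s + sgn R (neg s) * sgn R (neg a) * (t * g).1 y a := by
    intro y
    rw [← hti, ← mulVec_bv, ← mulVec_bv, ← mulVec_bv]
    show (((t * g).1 * (shortT (neg s) (neg a) _ has' (-1 : R)).1) *ᵥ bv R s) y = _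
    rw [← mulVec_mulVec, shortT_mulVec, mulVec_sub, mulVec_add, mulVec_smul, mulVec_smul]
    simp [neg_neg, hsa'.symm]
  have e' : ∀ c, (t * g).1 (neg a) c = g.1 (neg a) c := by
    intro c
    rw [shortT_mul_apply, if_neg (neg_ne_neg_iff.2 hsa.symm), if_neg (by rw [neg_neg]; exact neg_ne a),
      add_zero, sub_zero]
  rw [e, e', e'] at k1
  obtain ⟨c, hc⟩ := isUnit_iff_exists_inv.1 ((isUnit_sgn R (neg s)).mul (isUnit_sgn R (neg a)))
  refine hL.mono (i := neg a) (j := s) ?_ (ν.refl' _) (ν.symm' hs)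
  convert Ideal.mul_mem_left _ c (Ideal.sub_mem _ k1 k2) using 1
  linear_combination (-g.1 (neg a) a) * hc

/-- Every element of the radical part of `H` can be multiplied by elementary transvections from
the net so that `heis_of_zeros` applies. The property `P` records invariants of the process. -/
theorem exists_zeros (hL : IsLevel ν H N) {g : Sp n R} (hg : g ∈ radicalPart H) {r : Idx n}
    (hr : ¬ ν r (neg r)) (P : Sp n R → Prop) (hP : P g)
    (hstep : ∀ g ∈ radicalPart H, P g → ∀ (i j : Idx n) (hij : j ≠ i) (hij' : j ≠ neg i) (x : R),
      x ∈ N.σ i j → (ν r i ∨ ν (neg r) i) → (ν r j ∨ ν (neg r) j) →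
      P (shortT i j hij hij' x * g)) :
    ∃ g' ∈ radicalPart H, P g' ∧ ∃ s k, ν r s ∧ ν r k ∧ s ≠ r ∧ k ≠ s ∧
      g'.1 k r = 0 ∧ g'.1 (neg s) r = 0 ∧ g'.1 k (neg s) = 0 := by
  have hν := hL.large
  have hns : ∀ {a b}, ν r a → ν r b → a ≠ neg b := fun {a b} ha hb e =>
    hr (hν.self_of_rel (ν.symm' hb) (ν.trans' (ν.symm' hb) (e ▸ ha)))
  have hneg : ∀ {x y}, ν r x → ν r y → neg x ≠ y := fun hx hy =>
    neg_ne_iff.2 (hns hx hy)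
  have hrr := ν.refl' r
  obtain ⟨s, hs, hsr, -⟩ := hν.exists_rel_ne r
  obtain ⟨k, hk, hkS⟩ := hν.exists_of_not_self hr {r, s} (Finset.card_le_two.trans (by norm_num))
  simp only [Finset.mem_insert, Finset.mem_singleton, not_or] at hkS
  obtain ⟨hkr, hks⟩ := hkS
  have hkn : ¬ ν (neg s) (neg (neg s)) := fun h => by
    rw [hν.neg_rel_iff] at h
    exact hr (hν.self_of_rel (ν.symm' hs) h)
  obtain ⟨g1, hg1, x1, hx1, rfl, z1, -, -, f1⟩ := hL.exists_clear hg (i := neg s) (j := r)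
    (hns hrr hs) (by rw [neg_neg]; exact hsr.symm) (hL.mem_opp hg hr hs)
  have hP1 := hstep g hg hP _ _ (hns hrr hs) (by rw [neg_neg]; exact hsr.symm) x1 hx1
    (Or.inr (hν.neg_rel hs)) (Or.inl hrr)
  set g1 := shortT (neg s) r (hns hrr hs) (by rw [neg_neg]; exact hsr.symm) x1 * g
  obtain ⟨g2, hg2, x2, hx2, rfl, z2, -, -, f2⟩ := hL.exists_clear hg1 (i := k) (j := r)
    (Ne.symm hkr) (hns hrr hk) (hL.mem_of_rel (ν.symm' hk) _)
  have hP2 := hstep g1 hg1 hP1 _ _ (Ne.symm hkr) (hns hrr hk) x2 hx2 (Or.inl hk) (Or.inl hrr)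
  set g2 := shortT k r (Ne.symm hkr) (hns hrr hk) x2 * g1
  -- The entry at `(k, -s)` is an opposite-block entry of column `-s`, since `k = -(-k)`. Clearing
  -- it adds a multiple of row `-s` to row `k`, which preserves the zero at `(k, r)` because `g2`
  -- vanishes at `(-s, r)`.
  have hm := hL.mem_opp hg2 (r := neg s) (a := neg k) hkn (hν.neg_rel (ν.trans' (ν.symm' hs) hk))
  rw [neg_neg] at hm
  obtain ⟨g3, hg3, x3, hx3, rfl, z3, -, r3, f3⟩ := hL.exists_clear hg2 (i := k) (j := neg s)
    (hneg hs hk) (neg_ne_neg_iff.2 (Ne.symm hks)) hm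
  have hP3 := hstep g2 hg2 hP2 _ _ (hneg hs hk) (neg_ne_neg_iff.2 (Ne.symm hks)) x3 hx3
    (Or.inl hk) (Or.inr (hν.neg_rel hs))
  have z2' : g2.1 (neg s) r = 0 := by
    rw [f2 _ _ (hneg hs hk) (neg_ne_neg_iff.2 hsr), z1]
  refine ⟨_, hg3, hP3, s, k, hs, hk, hsr, hks, ?_, ?_, z3⟩
  · rw [r3, z2, z2', mul_zero, add_zero]
  · rw [f3 _ _ (hneg hs hk) (by rw [neg_neg]; exact hneg hs hs), z2']

/-- The clearing transvections have both indices in the classes of `±r`, so row `q` is never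
altered. -/
theorem mem_of_not_rel (hL : IsLevel ν H N) {g : Sp n R} (hg : g ∈ radicalPart H) {r q : Idx n}
    (hr : ¬ ν r (neg r)) (hq : ¬ ν r q) (hq' : ¬ ν (neg r) q) : g.1 q r ∈ N.σ q r := by
  have hν := hL.large
  obtain ⟨g', hg', e, s, k, hs, hk, hsr, hks, h1, h2, h3⟩ := hL.exists_zeros hg hr
    (fun g' => g'.1 q r = g.1 q r) rfl (by
      intro g' _ hP i j hij hij' x _ hi hj
      rw [shortT_mul_apply, if_neg, if_neg, add_zero, sub_zero, hP]
      · rintro rfl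
        rcases hj with hj | hj
        · exact hq' (hν.neg_rel hj)
        · exact hq (hν.rel_neg_comm.2 hj)
      · rintro rfl
        exact hi.elim hq hq')
  rw [← e]
  exact hL.mem_of_zeros hg'.1 hr hs hk hsr hks h1 h2 h3 (isUnit_diag hg' _)
    (fun e => hq (e ▸ hk)) (fun e => hq' (e ▸ hν.neg_rel hk)) (fun _ h => hq (ν.symm' h))

theorem mem_of_mem_radicalPart (hL : IsLevel ν H N) {g : Sp n R} (hg : g ∈ radicalPart H)
    (i j : Idx n) : g.1 i j ∈ N.σ i j := by
  have hν := hL.large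
  by_cases hij : ν i j
  · exact hL.mem_of_rel hij _
  by_cases hj : ν j (neg j)
  · exact hL.mem_of_self hg.1 hj (isUnit_diag hg j) hij
  by_cases h : ν (neg j) i
  · have := hL.mem_opp hg hj (hν.rel_neg_comm.2 h)
    rwa [neg_neg] at this
  · exact hL.mem_of_not_rel hg hj (fun h => hij (ν.symm' h)) h

end IsLevel

end Jacobson

end SympNet

namespace SympNet

/-! ### Row lengths and the form parameters. -/

section Lengths

open Matrix

variable {n : ℕ} {R : Type*} [CommRing R] {H : Subgroup (Sp n R)} {ν : Setoid (Idx n)}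
  {N : FormNet n R}

/-- The quadratic form `∑_{k > 0} u_k u_{-k}`. -/
def quad (u : Idx n → R) : R := ∑ k : Fin n, u (Sum.inl k) * u (Sum.inr k)

theorem quad_add_smul_bv (u : Idx n → R) (c : R) (i : Idx n) :
    quad (u + c • bv R i) = quad u + c * u (neg i) := by
  rcases i with i | i
  · simp [quad, neg, add_mul, Finset.sum_add_distrib, Pi.single_apply]
  · simp [quad, neg, mul_add, Finset.sum_add_distrib, Pi.single_apply, mul_comm]

theorem rowLength_eq (g : Sp n R) (i : Idx n) :
    rowLength g i = sgn R i * quad ((g⁻¹).1 *ᵥ bv R (neg i)) := by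
  rw [rowLength, quad, Finset.mul_sum]
  refine Finset.sum_congr rfl fun k _ => ?_
  have := inv_apply g⁻¹ i (Sum.inl k)
  rw [inv_inv] at this
  rw [this, IsLevel.mulVec_bv, IsLevel.mulVec_bv]
  simp [sgn, neg]; ring

/-- The vector which agrees with `u` on `S` and vanishes elsewhere. -/
def restrict (S : Finset (Idx n)) (u : Idx n → R) : Idx n → R := fun i => if i ∈ S then u i else 0

theorem restrict_insert {S : Finset (Idx n)} {i : Idx n} (hi : i ∉ S) (u : Idx n → R) :
    restrict (insert i S) u = restrict S u + u i • bv R i := by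
  ext j
  by_cases h : j = i
  · subst h; simp [restrict, hi]
  · simp [restrict, h]

/-- The positive indices. -/
def posIdx (n : ℕ) : Finset (Idx n) := Finset.univ.image Sum.inl

/-- The negative indices. -/
def negIdx (n : ℕ) : Finset (Idx n) := Finset.univ.image Sum.inr

theorem restrict_posIdx_add (u : Idx n → R) :
    restrict (posIdx n) u + restrict (negIdx n) u = u := by
  ext (i | i) <;> simp [restrict, posIdx, negIdx]

theorem neg_notMem_posIdx {i : Idx n} (hi : i ∈ posIdx n) : neg i ∉ posIdx n := by
  rcases i with i | i <;> simp_all [posIdx, neg]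

theorem neg_notMem_negIdx {i : Idx n} (hi : i ∈ negIdx n) : neg i ∉ negIdx n := by
  rcases i with i | i <;> simp_all [negIdx, neg]

theorem sharp_dotProduct_restrict_posIdx (u : Idx n → R) :
    sharp u ⬝ᵥ restrict (posIdx n) u = - quad u := by
  simp only [dotProduct, Fintype.sum_sum_type, quad, sharp, restrict, posIdx]
  simp [sgn, neg, mul_comm]

namespace IsLevel

/-- When `S` contains no opposite pair, the coordinate vectors are mutually orthogonal, so the
element is a product of root elements without cocycle. The coordinate at `-k` gives a long root
element with doubled parameter, covered by `2σ ≤ Γ`. -/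
theorem heis_restrict_mem (hL : IsLevel ν H N) {k r : Idx n} (hk : ν r k) {u : Idx n → R}
    (hu : ∀ q, u q ∈ N.σ q r) (huk : u k = 0) (S : Finset (Idx n)) (hS : ∀ i ∈ S, neg i ∉ S) :
    InSub H (heis (bv R (neg k)) (restrict S u) 0) := by
  induction S using Finset.induction_on with
  | empty =>
    have : restrict ∅ u = 0 := by ext i; simp [restrict]
    rw [this, heis_zero]
    exact ⟨1, H.one_mem, rfl⟩
  | insert i S hi ih =>
    have h1 := ih fun j hj hj' => hS j (Finset.mem_insert_of_mem hj) (Finset.mem_insert_of_mem hj')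
    have h2 : InRoot H (neg k) i (u i) := by
      by_cases hik : i = k
      · rw [hik, huk]; exact inRoot_zero H _ _
      have hm := hL.mono (hu i) (ν.refl' i) hk
      by_cases hik' : i = neg k
      · subst hik'
        rw [← inLong_two_mul]
        apply hL.inLong_of_mem
        apply N.two_mul_mem
        rwa [neg_neg]
      · exact (hL.inRoot_of_mem hm (Ne.symm hik) (ne_neg_comm.1 hik')).symm
    have h3 : sharp (bv R (neg k)) ⬝ᵥ restrict S u = 0 := by
      rw [sharp_bv_dotProduct, neg_neg, restrict]
      simp [huk]
    have h4 : sharp (bv R (neg k)) ⬝ᵥ (u i • bv R i) = 0 := by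
      by_cases hik : i = k
      · rw [hik, huk, zero_smul, dotProduct_zero]
      · exact sharp_bv_smul (by rwa [neg_neg]) _
    have h5 : sharp (restrict S u) ⬝ᵥ (u i • bv R i) = 0 := by
      have : neg i ∉ S := fun h => hS i (Finset.mem_insert_self i S) (Finset.mem_insert_of_mem h)
      rw [dotProduct_smul, dotProduct_bv, sharp, restrict, if_neg this]
      simp
    have := h1.heis_mul h2 h3 h4
    rwa [h5, add_zero, add_zero, ← restrict_insert hi] at this

/-- Split `u` into its positive and negative parts, which are both isotropic. Dividing by the two
corresponding elements of `H` kills the vector, and the cocycle `-⟨u, u₊⟩ = quad u` remains as a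
long root parameter. -/
theorem quad_mem_of_heis (hL : IsLevel ν H N) {k r : Idx n} (hk : ν r k) {u : Idx n → R}
    (hu : ∀ q, u q ∈ N.σ q r) (huk : u k = 0) (h : InSub H (heis (bv R (neg k)) u 0)) :
    quad u ∈ N.Γ (neg r) := by
  have orth : ∀ S, sharp (bv R (neg k)) ⬝ᵥ restrict S u = 0 := fun S => by
    rw [sharp_bv_dotProduct, neg_neg, restrict]
    simp [huk]
  have orth' : ∀ S, sharp (bv R (neg k)) ⬝ᵥ (-restrict S u) = 0 := fun S => by
    rw [dotProduct_neg, orth, neg_zero]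
  have h1 := (hL.heis_restrict_mem hk hu huk (posIdx n)
    fun _ => neg_notMem_posIdx).heis_neg (orth _)
  have h2 := (hL.heis_restrict_mem hk hu huk (negIdx n)
    fun _ => neg_notMem_negIdx).heis_neg (orth _)
  have e1 : u + -restrict (posIdx n) u = restrict (negIdx n) u := by
    conv_lhs => rw [← restrict_posIdx_add u]
    have : restrict (posIdx n) (restrict (posIdx n) u + restrict (negIdx n) u) =
      restrict (posIdx n) u := by rw [restrict_posIdx_add]
    rw [this]; abel
  have h3 := h.heis_mul h1 (by rw [sharp_bv_dotProduct, neg_neg, huk, mul_zero]) (orth' _)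
  rw [e1, dotProduct_neg, sharp_dotProduct_restrict_posIdx, _root_.neg_neg, neg_zero, add_zero,
    zero_add] at h3
  have h4 := h3.heis_mul h2 (orth _) (orth' _)
  rw [add_neg_cancel, dotProduct_neg, sharp_dotProduct_self, neg_zero, add_zero, add_zero] at h4
  exact hL.mem_of_inLong h4 (hL.large.neg_rel (ν.symm' hk))

/-- The quadratic form changes by `(1 - ε_i ε_j) u_{-i} x u_j`, which is 0 or twice an element of
`σ_{-r,r}`. Hence its class modulo Γ survives the clearing process. -/
theorem quad_step (hL : IsLevel ν H N) {r i j : Idx n} {u : Idx n → R}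
    (hu : ∀ q, u q ∈ N.σ q r) (hij : j ≠ i) (hij' : j ≠ neg i) {x : R} (hx : x ∈ N.σ i j) :
    quad ((shortT i j hij hij' x).1 *ᵥ u) - quad u ∈ N.Γ (neg r) := by
  have e : quad ((shortT i j hij hij' x).1 *ᵥ u) - quad u =
      (1 - sgn R i * sgn R j) * (u (neg i) * (x * u j)) := by
    rw [shortT_mulVec, sub_eq_add_neg (_ + _), ← neg_smul, quad_add_smul_bv, quad_add_smul_bv]
    simp [neg_neg, hij]
    ring
  have hm : u (neg i) * (x * u j) ∈ N.σ (neg r) r := by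
    have h1 := hu (neg i)
    rw [hL.unitary, neg_neg] at h1
    exact N.mul_le _ _ i (Ideal.mul_mem_mul h1 (N.mul_le _ _ j (Ideal.mul_mem_mul hx (hu j))))
  have h2 : 2 * (u (neg i) * (x * u j)) ∈ N.Γ (neg r) :=
    N.two_mul_mem _ _ (by rwa [neg_neg])
  rw [e]
  rcases sgn_eq_or R i with hi | hi <;> rcases sgn_eq_or R j with hj | hj <;> rw [hi, hj]
  · convert (N.Γ (neg r)).zero_mem using 1; ring
  · convert h2 using 1; ring
  · convert h2 using 1; ring
  · convert (N.Γ (neg r)).zero_mem using 1; ring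

theorem quad_mem (hL : IsLevel ν H N) {g : Sp n R} (hg : g ∈ radicalPart H) (r : Idx n) :
    quad (g.1 *ᵥ bv R r) ∈ N.Γ (neg r) := by
  have hν := hL.large
  by_cases hr : ν r (neg r)
  · exact hL.mem_of_inLong (inLong_of_rel hL.block_le hr _) hr
  have hσ : ∀ g ∈ radicalPart H, ∀ q, (g.1 *ᵥ bv R r) q ∈ N.σ q r := fun g hg q => by
    rw [mulVec_bv]; exact hL.mem_of_mem_radicalPart hg q r
  obtain ⟨g', hg', e, s, k, hs, hk, hsr, hks, h1, h2, h3⟩ := hL.exists_zeros hg hr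
    (fun g' => quad (g'.1 *ᵥ bv R r) - quad (g.1 *ᵥ bv R r) ∈ N.Γ (neg r))
    (by rw [sub_self]; exact zero_mem _) (by
      intro g' hg' hP i j hij hij' x hx _ _
      have := add_mem (hL.quad_step (hσ g' hg') hij hij' hx) hP
      rw [sub_add_sub_cancel, mulVec_mulVec] at this
      exact this)
  have c := hL.heis_of_zeros hg'.1 hr hs hk hsr hks h1 h2 h3 (isUnit_diag hg' _) 1
  rw [one_smul] at c
  have := sub_mem (hL.quad_mem_of_heis hk (hσ g' hg') (by rw [mulVec_bv, h1]) c) e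
  rwa [sub_sub_cancel] at this

theorem rowLength_mem (hL : IsLevel ν H N) {g : Sp n R} (hg : g ∈ radicalPart H) (i : Idx n) :
    rowLength g i ∈ N.Γ i := by
  have := hL.quad_mem (inv_mem hg) (neg i)
  rw [neg_neg] at this
  rw [rowLength_eq]
  rcases sgn_eq_or R i with h | h
  · rwa [h, one_mul]
  · rw [h, neg_one_mul]; exact neg_mem this

end IsLevel

end Lengths

end SympNet

theorem mainTheorem4 {R : Type*} [CommRing R] (n : ℕ)
    (ν : Setoid (SympNet.Idx n)) (hν : SympNet.IsUnitaryRel ν)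
    (hsize : ((4, 5) : ℕ∞ × ℕ∞) ≤ SympNet.minSizes ν)
    (H : Subgroup (SympNet.Sp n R)) (hH : SympNet.blockElem ν R ≤ H)
    (N : SympNet.FormNet n R) (hN : N.IsAssociated H) :
    ((H ⊓ SympNet.congruenceSubgroup n (Ring.jacobson R) : Subgroup (SympNet.Sp n R)) :
      Set (SympNet.Sp n R)) ⊆ N.sp := by
  intro g hg
  have hL := hN.isLevel (SympNet.isLargeRel_of_minSizes hν hsize) hH
  exact ⟨fun i j => hL.mem_of_mem_radicalPart hg i j, fun i => hL.rowLength_mem hg i⟩
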